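/- \textbf{Theorem 4.4.} Let $Q=Q_1Q_2Q_3Q_4$ be a (nondegenerate) convex quadrilateral in the plane, with vertices named anticlockwise so that the diagonal $Q_1Q_3$ is not longer than the diagonal $Q_2Q_4$. Every $x\in Q$ has a unique representation $x=\sum_{i=1}^4\alpha_iQ_i$ with $\alpha_i\ge 0$, $\sum_i\alpha_i=1$ and $\alpha_2=0$ or $\alpha_4=0$; for a quadrilateral $R=R_1R_2R_3R_4$ put $P_R(x)=\sum_i\alpha_iR_i$. For an integer $m\ge 4$ let $A$ be the set of all $k=(k_1,k_2,k_3,k_4)$ of non-negative integers with $k_1+k_2+k_3+k_4=m-1$ and $k_2=0$ or $k_4=0$. For $k\in A$ let $S_m(k)=R_1R_2R_3R_4$, where $$R_1=\tfrac1m\Big(Q_1+\sum_i k_iQ_i\Big),\qquad R_3=\tfrac1m\Big(Q_3+\sum_i k_iQ_i\Big),$$ $R_2=\frac1m\big(Q_2+\sum_i k_iQ_i\big)$ if $k_4=0$ and $R_2=\frac1m\big(Q_1+Q_3-Q_4+\sum_i k_iQ_i\big)$ if $k_4\ne0$, and $R_4=\frac1m\big(Q_4+\sum_i k_iQ_i\big)$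 if $k_2=0$ and $R_4=\frac1m\big(Q_1-Q_2+Q_3+\sum_i k_iQ_i\big)$ if $k_2\neq 0$. These $m^2$ quadrilaterals subdivide $Q$; call $S_m(k)$ a border quadrilateral if it lies along a side of $Q$, i.e. if all nonzero $k_j$ belong to the two endpoints of one side of $Q$. A set $\mathcal W_1\subseteq\{S_m(k):k\in A\}$ is an $m\times m$ quadrilateral labyrinth set if \begin{enumerate} \item the graph with vertex set $\mathcal W_1$, in which two distinct quadrilaterals are adjacent when they have a common side, is a tree; \item there is exactly one $(k_1,k_2,0,0)\in A$ such that $S_m(k_1,k_2,0,0)$ and $S_m(0,0,k_2,k_1)$ are both in $\mathcal W_1$ (the left and the right exit), and exactly one $(k_1,0,0,k_4)\in A$ such that $S_m(k_1,0,0,k_4)$ and $S_m(0,k_1,k_4,0)$ are both in $\mathcal W_1$ (the top and the bottom exit); \item $\mathcal W_1$ contains at most one of $S_m(m-1,0,0,0)$, $S_m(0,0,m-1,0)$ and at most one of $S_m(0,m-1,0,0)$, $S_m(0,0,0,m-1)$. \end{enumerate} For $n\ge2$ let $\mathcal W_n=\{P_V(U):V\in\mathcal W_{n-1},\,U\in\mathcal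 W_1\}$, where $P_V(U)$ is the quadrilateral whose vertices are the images under $P_V$ of the vertices of $U$, in order, and let $L_\infty=\bigcap_{n\ge1}\bigcup_{W\in\mathcal W_n}W$. Suppose that $m\ge4$ and that $\mathcal W_1$ is an $m\times m$ quadrilateral labyrinth set in $Q$ that contains no border quadrilateral except the exits. Then $Q\setminus L_\infty$ has exactly $4$ connected components; moreover, all four vertices of $Q$ lie in $Q\setminus L_\infty$, and each component contains exactly one of them. -/

import Mathlib

namespace QuadLabyrinth

/-- The Euclidean plane. -/
abbrev Plane : Type := EuclideanSpace ℝ (Fin 2)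

/-- A quadrilateral `R₁R₂R₃R₄`, given by its vertices in cyclic order.
The indices `0, 1, 2, 3` stand for `1, 2, 3, 4`. -/
abbrev Quad : Type := Fin 4 → Plane

/-- The planar cross product. -/
def cross (u v : Plane) : ℝ := u 0 * v 1 - u 1 * v 0

/-- `Q₁Q₂Q₃Q₄` is a (nondegenerate) convex quadrilateral listed anticlockwise:
at each of the four vertices the boundary makes a strict left turn. -/
def IsConvexQuad (Q : Quad) : Prop :=
  ∀ i : Fin 4, 0 < cross (Q (i + 1) - Q i) (Q (i + 2) - Q (i + 1))

/-- The points of a convex quadrilateral. -/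
def carrier (R : Quad) : Set Plane := convexHull ℝ (Set.range R)

/-- `α` is a representation of `x` in `Q`: barycentric coordinates in the triangle `Q₁Q₂Q₃`
(then `α₄ = 0`) or in the triangle `Q₃Q₄Q₁` (then `α₂ = 0`). -/
def IsRep (Q : Quad) (x : Plane) (α : Fin 4 → ℝ) : Prop :=
  (∀ i, 0 ≤ α i) ∧ ∑ i, α i = 1 ∧ (α 1 = 0 ∨ α 3 = 0) ∧ ∑ i, α i • Q i = x

/-- The representation of a point `x` of `Q`. It exists and is unique if `Q` is convex and
`x` lies in `Q`; for other points the value is irrelevant. -/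
noncomputable def rep (Q : Quad) (x : Plane) : Fin 4 → ℝ := Classical.epsilon (IsRep Q x)

/-- The map `P_R : Q → R`, `∑ αᵢ Qᵢ ↦ ∑ αᵢ Rᵢ`. -/
noncomputable def P (Q R : Quad) (x : Plane) : Plane := ∑ i, rep Q x i • R i

def A₁ (m : ℕ) : Set (Fin 4 → ℕ) := {k | k 0 + k 1 + k 2 + 1 = m ∧ k 3 = 0 ∧ k 1 ≠ 0}

def A₂ (m : ℕ) : Set (Fin 4 → ℕ) := {k | k 0 + k 2 + k 3 + 1 = m ∧ k 1 = 0 ∧ k 3 ≠ 0}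

def A₃ (m : ℕ) : Set (Fin 4 → ℕ) := {k | k 0 + k 2 + 1 = m ∧ k 1 = 0 ∧ k 3 = 0}

/-- The index set of the subdivision of `Q` into `m²` quadrilaterals. -/
def A (m : ℕ) : Set (Fin 4 → ℕ) := A₁ m ∪ A₂ m ∪ A₃ m

/-- The point `((k₁+c₁)Q₁ + (k₂+c₂)Q₂ + (k₃+c₃)Q₃ + (k₄+c₄)Q₄) / m`. -/
noncomputable def gridPoint (Q : Quad) (m : ℕ) (k : Fin 4 → ℕ) (c : Fin 4 → ℝ) : Plane :=
  (m : ℝ)⁻¹ • ∑ i, ((k i : ℝ) + c i) • Q i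

/-- The quadrilateral `S_m(k₁,k₂,k₃,k₄)`; for `k ∈ A m` the three cases are
`k ∈ A₁ m`, `k ∈ A₂ m` and `k ∈ A₃ m`. -/
noncomputable def S (Q : Quad) (m : ℕ) (k : Fin 4 → ℕ) : Quad :=
  if k 1 ≠ 0 then
    ![gridPoint Q m k ![1, 0, 0, 0], gridPoint Q m k ![0, 1, 0, 0],
      gridPoint Q m k ![0, 0, 1, 0], gridPoint Q m k ![1, -1, 1, 0]]
  else if k 3 ≠ 0 then
    ![gridPoint Q m k ![1, 0, 0, 0], gridPoint Q m k ![1, 0, 1, -1],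
      gridPoint Q m k ![0, 0, 1, 0], gridPoint Q m k ![0, 0, 0, 1]]
  else
    ![gridPoint Q m k ![1, 0, 0, 0], gridPoint Q m k ![0, 1, 0, 0],
      gridPoint Q m k ![0, 0, 1, 0], gridPoint Q m k ![0, 0, 0, 1]]

/-- The set `𝒮_m` of all quadrilaterals of the subdivision. -/
def grid (Q : Quad) (m : ℕ) : Set Quad := S Q m '' A m

/-- The quadrilaterals `R` and `T` have a common side. -/
def HaveCommonSide (R T : Quad) : Prop :=
  ∃ i j : Fin 4, segment ℝ (R i) (R (i + 1)) = segment ℝ (T j) (T (j + 1))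

/-- The graph of a set of white quadrilaterals: two distinct ones are adjacent if they have a
common side. -/
def whiteGraph (W : Set Quad) : SimpleGraph W where
  Adj R T := R ≠ T ∧ HaveCommonSide R.1 T.1
  symm := ⟨fun _ _ h => ⟨h.1.symm, let ⟨i, j, e⟩ := h.2; ⟨j, i, e.symm⟩⟩⟩
  loopless := ⟨fun _ h => h.1 rfl⟩

/-- `k = (k₁,k₂,0,0) ∈ A` with `S_m(k₁,k₂,0,0)` and `S_m(0,0,k₂,k₁)` both white. -/
def IsLeftRightPair (Q : Quad) (m : ℕ) (W : Set Quad) (k : Fin 4 → ℕ) : Prop :=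
  k ∈ A m ∧ k 2 = 0 ∧ k 3 = 0 ∧ S Q m k ∈ W ∧ S Q m ![0, 0, k 1, k 0] ∈ W

/-- `k = (k₁,0,0,k₄) ∈ A` with `S_m(k₁,0,0,k₄)` and `S_m(0,k₁,k₄,0)` both white. -/
def IsTopBottomPair (Q : Quad) (m : ℕ) (W : Set Quad) (k : Fin 4 → ℕ) : Prop :=
  k ∈ A m ∧ k 1 = 0 ∧ k 2 = 0 ∧ S Q m k ∈ W ∧ S Q m ![0, k 0, k 3, 0] ∈ W

/-- `W` is an `m × m` quadrilateral labyrinth set in `Q` (where `m ≥ 4`). -/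
structure IsLabyrinthSet (Q : Quad) (m : ℕ) (W : Set Quad) : Prop where
  subset_grid : W ⊆ grid Q m
  tree : (whiteGraph W).IsTree
  exit_left_right : ∃! k : Fin 4 → ℕ, IsLeftRightPair Q m W k
  exit_top_bottom : ∃! k : Fin 4 → ℕ, IsTopBottomPair Q m W k
  corner₁₃ : ¬ (S Q m ![m - 1, 0, 0, 0] ∈ W ∧ S Q m ![0, 0, m - 1, 0] ∈ W)
  corner₂₄ : ¬ (S Q m ![0, m - 1, 0, 0] ∈ W ∧ S Q m ![0, 0, 0, m - 1] ∈ W)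

/-- `R` is the left, right, top or bottom exit of `W`. -/
def IsExit (Q : Quad) (m : ℕ) (W : Set Quad) (R : Quad) : Prop :=
  (∃ k, IsLeftRightPair Q m W k ∧ (R = S Q m k ∨ R = S Q m ![0, 0, k 1, k 0])) ∨
  (∃ k, IsTopBottomPair Q m W k ∧ (R = S Q m k ∨ R = S Q m ![0, k 0, k 3, 0]))

/-- `S_m(k)` is a border quadrilateral, i.e. it lies along some side `QᵢQᵢ₊₁` of `Q`: at most two
of the `kⱼ` are nonzero, and these belong to the endpoints of a side of `Q`. -/
def IsBorderIndex (k : Fin 4 → ℕ) : Prop :=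
  ∃ i : Fin 4, ∀ j : Fin 4, k j ≠ 0 → j = i ∨ j = i + 1

/-- The set `𝒲_{n+1}` of white quadrilaterals of order `n + 1` generated by `W = 𝒲₁`. The
quadrilateral `P_V(U)` is given by its vertices `P_V(U₁), …, P_V(U₄)`. -/
def white (Q : Quad) (W : Set Quad) : ℕ → Set Quad
  | 0 => W
  | n + 1 => {R | ∃ V ∈ white Q W n, ∃ U ∈ W, R = fun i => P Q V (U i)}

/-- The labyrinth fractal `L_∞`, the intersection over all orders of the unions of the white
quadrilaterals of that order. -/
def fractal (Q : Quad) (W : Set Quad) : Set Plane :=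
  ⋂ n : ℕ, ⋃ R ∈ white Q W n, carrier R

end QuadLabyrinth

open QuadLabyrinth

/-! The problem is pulled back to the unit square. The map `quadMap Q`, affine on each side of the
diagonal, is a homeomorphism of the square onto `Q` and carries the square `m × m` grid to the
quadrilaterals of the subdivision. Its restriction to a subsquare that is bisected by the diagonal
or lies on one side of it is again of the form `quadMap R` (`IsAdapted.quadMap_imageQuad`), so
iterating `P` amounts to composing homotheties, and `fractal Q W` is the image of `squareFractal`. A
corner cell is never an exit (`exit_ne_corner`), so all corner cells are black.

At most four components: a point off the fractal is excluded at some finite order. In a black cell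
it can be joined to every vertex of that cell off the fractal; in a white cell it can, by induction,
be joined to some vertex. Every lattice point can be joined to a corner of the square
(`IsPattern.forall_lattice`): otherwise the lattice sides with exactly one end in the set of such
points would be crossed by edges of the white tree forming a nonempty subgraph without leaves.

At least four: a white path from the bottom to the top exit labels the lattice points as left or
right of it, and one from left to right labels them as below or above. The pair of labels is
constant on the vertices of each black cell and tells the four corners apart. Applied recursively
inside white cells it extends to a function off the fractal; the values match across common sides
because of `IsPattern.sideLabels`, so the function is locally constant
(`IsPattern.exists_locally_constant`). `bijective_mk_of_image` combines the two halves. -/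

namespace QuadLabyrinth

/-! ### Patterns of white cells and labellings of lattice points -/

section

/-- A finite forest with an edge has a leaf: without leaves a path could be prolonged forever,
because by acyclicity the only neighbour of its last vertex lying on the path is the penultimate
one. -/
theorem IsAcyclic.eq_bot_of_forall_exists_adj_ne {V : Type*} [Finite V] {G : SimpleGraph V}
    (hG : G.IsAcyclic) (h : ∀ u v, G.Adj u v → ∃ w, w ≠ u ∧ G.Adj v w) (u v : V) : ¬ G.Adj u v := by
  classical
  intro huv
  have := Fintype.ofFinite V
  have key : ∀ n : ℕ, ∃ (b : V) (p : G.Walk u b), p.IsPath ∧ p.length = n + 1 := by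
    intro n
    induction n with
    | zero =>
      exact ⟨v, .cons huv .nil, by simp [huv.ne], rfl⟩
    | succ n ih =>
      obtain ⟨b, p, hp, hl⟩ := ih
      have hnil : ¬ p.Nil := by
        intro hn
        have := SimpleGraph.Walk.length_eq_zero_iff.2 hn
        omega
      obtain ⟨w, hw, hbw⟩ := h _ _ (p.adj_penultimate hnil)
      have hws : w ∉ p.support := fun hs => hw (hG.eq_penultimate_of_adj_end hp hbw hs)
      exact ⟨w, p.concat hbw, hp.concat hws hbw, by simp [hl]⟩
  obtain ⟨b, p, hp, hl⟩ := key (Fintype.card V)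
  have := hp.length_lt
  omega

/-- Two cells of the unit grid are neighbours if they share a side. -/
def Neighbor (a b : ℕ × ℕ) : Prop :=
  (b.1 = a.1 + 1 ∧ b.2 = a.2) ∨ (a.1 = b.1 + 1 ∧ b.2 = a.2) ∨
  (b.1 = a.1 ∧ b.2 = a.2 + 1) ∨ (b.1 = a.1 ∧ a.2 = b.2 + 1)

theorem Neighbor.symm {a b : ℕ × ℕ} (h : Neighbor a b) : Neighbor b a := by
  unfold Neighbor at *; omega

/-- The graph of white cells. -/
def cellGraph (w : ℕ × ℕ → Prop) : SimpleGraph {a : ℕ × ℕ // w a} where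
  Adj a b := Neighbor a.1 b.1
  symm := ⟨fun _ _ h => h.symm⟩
  loopless := ⟨fun _ h => by unfold Neighbor at h; omega⟩

/-- `w` is the set of white cells of a square labyrinth pattern of width `m` whose only white
border cells are the two exits in column `c` and the two exits in row `r`. -/
structure IsPattern (m : ℕ) (w : ℕ × ℕ → Prop) (c r : ℕ) : Prop where
  lt : ∀ a, w a → a.1 < m ∧ a.2 < m
  left : ∀ y, w (0, y) ↔ y = r
  right : ∀ y, w (m - 1, y) ↔ y = r
  bottom : ∀ x, w (x, 0) ↔ x = c
  top : ∀ x, w (x, m - 1) ↔ x = c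
  c_pos : 0 < c
  c_lt : c + 1 < m
  r_pos : 0 < r
  r_lt : r + 1 < m
  tree : (cellGraph w).IsTree

variable {m c r : ℕ} {w : ℕ × ℕ → Prop}

theorem IsPattern.finite (h : IsPattern m w c r) : Finite {a : ℕ × ℕ // w a} := by
  have : {a | w a} ⊆ Set.Iio m ×ˢ Set.Iio m := fun a ha => h.lt a ha
  exact ((Set.finite_Iio m).prod (Set.finite_Iio m)).subset this

/-- The exceptional step `e` will be the exit on a side of the grid; the property spreads towards it
from both ends of the side. -/
theorem forall_le_of_step {D : ℕ → Prop} {e : ℕ} (he : e < m) (h0 : D 0) (hm : D m)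
    (hD : ∀ j < m, j ≠ e → (D j ↔ D (j + 1))) : ∀ j ≤ m, D j := by
  have up : ∀ j ≤ e, D j := by
    intro j
    induction j with
    | zero => intro _; exact h0
    | succ j ih => intro hj; exact (hD j (by omega) (by omega)).1 (ih (by omega))
  have down : ∀ i, i + e + 1 ≤ m → D (m - i) := by
    intro i
    induction i with
    | zero => intro _; exact hm
    | succ i ih =>
      intro hi
      refine (hD (m - (i + 1)) (by omega) (by omega)).2 ?_
      have : m - (i + 1) + 1 = m - i := by omega
      rw [this]
      exact ih (by omega)
  intro j hj
  by_cases hje : j ≤ e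
  · exact up j hje
  · have := down (m - j) (by omega)
    rwa [show m - (m - j) = j by omega] at this

/-- The lattice edge separating two neighbouring cells has exactly one end in `C`. -/
def Crosses (C : ℕ × ℕ → Prop) (a b : ℕ × ℕ) : Prop :=
  (b.1 = a.1 + 1 ∧ b.2 = a.2 ∧ ¬(C (b.1, b.2) ↔ C (b.1, b.2 + 1))) ∨
  (a.1 = b.1 + 1 ∧ b.2 = a.2 ∧ ¬(C (a.1, a.2) ↔ C (a.1, a.2 + 1))) ∨
  (b.1 = a.1 ∧ b.2 = a.2 + 1 ∧ ¬(C (b.1, b.2) ↔ C (b.1 + 1, b.2))) ∨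
  (b.1 = a.1 ∧ a.2 = b.2 + 1 ∧ ¬(C (a.1, a.2) ↔ C (a.1 + 1, a.2)))

/-- A set of lattice points which contains the corners of the grid, and with one vertex of a black
cell all its vertices, contains all lattice points. -/
theorem IsPattern.forall_lattice (h : IsPattern m w c r) (C : ℕ × ℕ → Prop)
    (hblack : ∀ x y, x < m → y < m → ¬ w (x, y) →
      (C (x, y) ↔ C (x + 1, y)) ∧ (C (x, y) ↔ C (x, y + 1)) ∧ (C (x, y) ↔ C (x + 1, y + 1)))
    (h00 : C (0, 0)) (h10 : C (m, 0)) (h01 : C (0, m)) (h11 : C (m, m))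
    (x y : ℕ) (hx : x ≤ m) (hy : y ≤ m) : C (x, y) := by
  have hc := h.c_lt
  have hr := h.r_lt
  have hleft : ∀ j ≤ m, C (0, j) := forall_le_of_step (D := fun j => C (0, j)) (e := r) (by omega) h00 h01
    fun j hj hjr => (hblack 0 j (by omega) hj (by rwa [h.left])).2.1
  have hbot : ∀ j ≤ m, C (j, 0) := forall_le_of_step (D := fun j => C (j, 0)) (e := c) (by omega) h00 h10
    fun j hj hjr => (hblack j 0 hj (by omega) (by rwa [h.bottom])).1
  have hright : ∀ j ≤ m, C (m, j) := forall_le_of_step (D := fun j => C (m, j)) (e := r) (by omega) h10 h11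
    fun j hj hjr => by
      have := hblack (m - 1) j (by omega) hj (by rwa [h.right])
      rw [show m - 1 + 1 = m by omega] at this
      tauto
  have htop : ∀ j ≤ m, C (j, m) := forall_le_of_step (D := fun j => C (j, m)) (e := c) (by omega) h01 h11
    fun j hj hjr => by
      have := hblack j (m - 1) hj (by omega) (by rwa [h.top])
      rw [show m - 1 + 1 = m by omega] at this
      tauto
  -- no side between white cells has exactly one end in `C`
  have hfin := h.finite
  let G : SimpleGraph {a : ℕ × ℕ // w a} :=
    { Adj := fun a b => Crosses C a.1 b.1
      symm := ⟨fun a b hab => by unfold Crosses at *; grind⟩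
      loopless := ⟨fun a hab => by unfold Crosses at *; omega⟩ }
  have hGle : G ≤ cellGraph w := by
    intro a b hab
    simp only [G, Crosses, cellGraph, Neighbor] at *
    tauto
  -- a side of a white cell with exactly one end in `C` belongs to another white cell
  have hR : ∀ x y, w (x, y) → ¬(C (x + 1, y) ↔ C (x + 1, y + 1)) → w (x + 1, y) := by
    intro x y hw hne
    by_contra hb
    have hlt := h.lt _ hw
    simp only at hlt
    by_cases hxm : x + 1 = m
    · rw [hxm] at hne
      exact hne (iff_of_true (hright _ (by omega)) (hright _ (by omega)))
    · exact hne (hblack (x + 1) y (by omega) (by omega) hb).2.1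
  have hL : ∀ x y, w (x, y) → ¬(C (x, y) ↔ C (x, y + 1)) → ∃ x', x = x' + 1 ∧ w (x', y) := by
    intro x y hw hne
    have hlt := h.lt _ hw
    simp only at hlt
    cases x with
    | zero => exact absurd (iff_of_true (hleft _ (by omega)) (hleft _ (by omega))) hne
    | succ x =>
      refine ⟨x, rfl, ?_⟩
      by_contra hb
      have := hblack x y (by omega) (by omega) hb
      tauto
  have hT : ∀ x y, w (x, y) → ¬(C (x, y + 1) ↔ C (x + 1, y + 1)) → w (x, y + 1) := by
    intro x y hw hne
    by_contra hb
    have hlt := h.lt _ hw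
    simp only at hlt
    by_cases hxm : y + 1 = m
    · rw [hxm] at hne
      exact hne (iff_of_true (htop _ (by omega)) (htop _ (by omega)))
    · exact hne (hblack x (y + 1) (by omega) (by omega) hb).1
  have hB : ∀ x y, w (x, y) → ¬(C (x, y) ↔ C (x + 1, y)) → ∃ y', y = y' + 1 ∧ w (x, y') := by
    intro x y hw hne
    have hlt := h.lt _ hw
    simp only at hlt
    cases y with
    | zero => exact absurd (iff_of_true (hbot _ (by omega)) (hbot _ (by omega))) hne
    | succ y =>
      refine ⟨y, rfl, ?_⟩
      by_contra hb
      have := hblack x y (by omega) (by omega) hb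
      tauto
  -- Membership in `C` changes an even number of times round a cell, so a white cell entered through
  -- a changing side has a second one. Hence `G` has no leaves.
  have hGbot := IsAcyclic.eq_bot_of_forall_exists_adj_ne (h.tree.isAcyclic.anti hGle) (by
    rintro ⟨⟨x₁, y₁⟩, h₁⟩ ⟨⟨x, y⟩, hw⟩ hab
    have aR : ∀ hne : ¬(C (x + 1, y) ↔ C (x + 1, y + 1)),
        G.Adj ⟨(x, y), hw⟩ ⟨(x + 1, y), hR x y hw hne⟩ := fun hne => Or.inl ⟨rfl, rfl, hne⟩
    have aT : ∀ hne : ¬(C (x, y + 1) ↔ C (x + 1, y + 1)),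
        G.Adj ⟨(x, y), hw⟩ ⟨(x, y + 1), hT x y hw hne⟩ :=
      fun hne => Or.inr (Or.inr (Or.inl ⟨rfl, rfl, hne⟩))
    have aL : ¬(C (x, y) ↔ C (x, y + 1)) → ∃ x', ∃ h' : w (x', y), x = x' + 1 ∧
        G.Adj ⟨(x, y), hw⟩ ⟨(x', y), h'⟩ := fun hne => by
      obtain ⟨x', e, h'⟩ := hL x y hw hne
      exact ⟨x', h', e, Or.inr (Or.inl ⟨e, rfl, hne⟩)⟩
    have aB : ¬(C (x, y) ↔ C (x + 1, y)) → ∃ y', ∃ h' : w (x, y'), y = y' + 1 ∧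
        G.Adj ⟨(x, y), hw⟩ ⟨(x, y'), h'⟩ := fun hne => by
      obtain ⟨y', e, h'⟩ := hB x y hw hne
      exact ⟨y', h', e, Or.inr (Or.inr (Or.inr ⟨rfl, e, hne⟩))⟩
    by_contra hno
    push Not at hno
    have nR : ¬(C (x + 1, y) ↔ C (x + 1, y + 1)) → x₁ = x + 1 ∧ y₁ = y := fun hne => by
      by_contra hcon
      refine hno _ (fun e => hcon ?_) (aR hne)
      simp at e; omega
    have nT : ¬(C (x, y + 1) ↔ C (x + 1, y + 1)) → x₁ = x ∧ y₁ = y + 1 := fun hne => by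
      by_contra hcon
      refine hno _ (fun e => hcon ?_) (aT hne)
      simp at e; omega
    have nL : ¬(C (x, y) ↔ C (x, y + 1)) → x = x₁ + 1 ∧ y₁ = y := fun hne => by
      by_contra hcon
      obtain ⟨x', h', e', ha⟩ := aL hne
      refine hno _ (fun e => hcon ?_) ha
      simp at e; omega
    have nB : ¬(C (x, y) ↔ C (x + 1, y)) → x₁ = x ∧ y = y₁ + 1 := fun hne => by
      by_contra hcon
      obtain ⟨y', h', e', ha⟩ := aB hne
      refine hno _ (fun e => hcon ?_) ha
      simp at e; omega
    have iff_of {p : Prop} {q : Prop} (hpq : ¬ p → q) (hq : ¬ q) : p := by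
      by_contra hp; exact hq (hpq hp)
    rcases hab with ⟨e1, e2, hne⟩ | ⟨e1, e2, hne⟩ | ⟨e1, e2, hne⟩ | ⟨e1, e2, hne⟩ <;>
      simp only at e1 e2 hne <;> subst e1 e2
    · have iR := iff_of nR (by omega)
      have iT := iff_of nT (by omega)
      have iB := iff_of nB (by omega)
      rw [iB, iR, ← iT] at hne
      exact hne Iff.rfl
    · have iL := iff_of nL (by omega)
      have iT := iff_of nT (by omega)
      have iB := iff_of nB (by omega)
      rw [← iB, iL, iT] at hne
      exact hne Iff.rfl
    · have iL := iff_of nL (by omega)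
      have iT := iff_of nT (by omega)
      have iR := iff_of nR (by omega)
      rw [iL, iT, ← iR] at hne
      exact hne Iff.rfl
    · have iL := iff_of nL (by omega)
      have iB := iff_of nB (by omega)
      have iR := iff_of nR (by omega)
      rw [← iL, iB, iR] at hne
      exact hne Iff.rfl)
  -- A change along the right side of a white cell would be an edge of `G`, and along a side of a
  -- black cell it is impossible. So each column inherits the property from its bottom point.
  have hV : ∀ x y, x < m → y < m → (C (x + 1, y) ↔ C (x + 1, y + 1)) := by
    intro x y hx hy
    by_contra hne
    by_cases hw : w (x, y)
    · exact hGbot ⟨(x, y), hw⟩ ⟨(x + 1, y), hR x y hw hne⟩ (Or.inl ⟨rfl, rfl, hne⟩)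
    · have := hblack x y hx hy hw
      tauto
  cases x with
  | zero => exact hleft y hy
  | succ x =>
    have : ∀ y ≤ m, C (x + 1, y) := by
      intro y
      induction y with
      | zero => intro _; exact hbot _ hx
      | succ y ih => intro hy; exact (hV x y (by omega) (by omega)).1 (ih (by omega))
    exact this y hy

/-! ### Chains mod 2 across white paths, and the labellings they define -/

/-- A chain mod 2 of sides of white cells connecting `a` to `b`: `H x y` and `V x y` are the
multiplicities of the lattice edges going right and up from `(x, y)`. -/
def ChainConnected (w : ℕ × ℕ → Prop) (a b : ℕ × ℕ) : Prop :=
  ∃ H V : ℕ → ℕ → ZMod 2, (∀ x, H x 0 = 0) ∧ (∀ y, V 0 y = 0) ∧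
    (∀ x y, H x (y + 1) ≠ 0 → w (x, y) ∧ w (x, y + 1)) ∧
    (∀ x y, V (x + 1) y ≠ 0 → w (x, y) ∧ w (x + 1, y)) ∧
    ∀ x y, H x y + H x (y + 1) + V x y + V (x + 1) y =
      (if a = (x, y) then 1 else 0) + (if b = (x, y) then 1 else 0)

theorem ChainConnected.symm {a b : ℕ × ℕ} (h : ChainConnected w a b) : ChainConnected w b a := by
  obtain ⟨H, V, h1, h2, h3, h4, h5⟩ := h
  exact ⟨H, V, h1, h2, h3, h4, fun x y => by rw [h5, add_comm]⟩

theorem ChainConnected.refl (a : ℕ × ℕ) : ChainConnected w a a :=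
  ⟨0, 0, by simp, by simp, by simp, by simp, fun x y => by simp [CharTwo.add_self_eq_zero]⟩

/-- Chains are added mod 2; the two contributions of `b` to the boundary cancel. -/
theorem ChainConnected.trans {a b d : ℕ × ℕ} (h : ChainConnected w a b)
    (h' : ChainConnected w b d) : ChainConnected w a d := by
  obtain ⟨H, V, h1, h2, h3, h4, h5⟩ := h
  obtain ⟨H', V', h1', h2', h3', h4', h5'⟩ := h'
  refine ⟨H + H', V + V', by simp [h1, h1'], by simp [h2, h2'], fun x y hne => ?_,
    fun x y hne => ?_, fun x y => ?_⟩
  · by_cases h0 : H x (y + 1) = 0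
    · exact h3' x y (by simpa [h0] using hne)
    · exact h3 x y h0
  · by_cases h0 : V (x + 1) y = 0
    · exact h4' x y (by simpa [h0] using hne)
    · exact h4 x y h0
  · have e := congrArg₂ (· + ·) (h5 x y) (h5' x y)
    simp only [Pi.add_apply] at e ⊢
    have hb := CharTwo.add_self_eq_zero (if b = (x, y) then (1 : ZMod 2) else 0)
    linear_combination e + hb

theorem ChainConnected.of_right {x y : ℕ} (h : w (x, y)) (h' : w (x + 1, y)) :
    ChainConnected w (x, y) (x + 1, y) := by
  refine ⟨0, fun x' y' => if x' = x + 1 ∧ y' = y then 1 else 0, by simp, by simp, by simp,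
    fun x' y' hne => ?_, fun x' y' => ?_⟩
  · have : x' = x ∧ y' = y := by simpa using hne
    rw [this.1, this.2]; exact ⟨h, h'⟩
  · simp only [Pi.zero_apply, Prod.mk.injEq]
    rw [zero_add, zero_add, add_comm]
    congr 1 <;> grind

theorem ChainConnected.of_up {x y : ℕ} (h : w (x, y)) (h' : w (x, y + 1)) :
    ChainConnected w (x, y) (x, y + 1) := by
  refine ⟨fun x' y' => if x' = x ∧ y' = y + 1 then 1 else 0, 0, by simp, by simp,
    fun x' y' hne => ?_, by simp, fun x' y' => ?_⟩
  · have : x' = x ∧ y' = y := by simpa using hne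
    rw [this.1, this.2]; exact ⟨h, h'⟩
  · simp only [Pi.zero_apply, Prod.mk.injEq]
    rw [add_zero, add_zero, add_comm]
    congr 1 <;> grind

theorem ChainConnected.of_adj {a b : {a // w a}} (h : (cellGraph w).Adj a b) :
    ChainConnected w a.1 b.1 := by
  obtain ⟨⟨x, y⟩, ha⟩ := a
  obtain ⟨⟨x', y'⟩, hb⟩ := b
  rcases h with ⟨h1, h2⟩ | ⟨h1, h2⟩ | ⟨h1, h2⟩ | ⟨h1, h2⟩ <;> simp only at h1 h2 <;> subst h1 h2
  · exact of_right ha hb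
  · exact (of_right hb ha).symm
  · exact of_up ha hb
  · exact (of_up hb ha).symm

theorem ChainConnected.of_connected (h : (cellGraph w).Connected) {a b : ℕ × ℕ} (ha : w a)
    (hb : w b) : ChainConnected w a b := by
  obtain ⟨p⟩ := h.preconnected ⟨a, ha⟩ ⟨b, hb⟩
  suffices ∀ (u v : {a // w a}) (_ : (cellGraph w).Walk u v), ChainConnected w u.1 v.1 from
    this _ _ p
  intro u v p
  induction p with
  | nil => exact .refl _
  | cons hadj _ ih => exact (ChainConnected.of_adj hadj).trans ih

/-- A labelling of the lattice points by left and right that changes only along the sides crossed by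
a chain of white cells from bottom to top. -/
theorem exists_labelling (hm : 0 < m) (hlt : ∀ a, w a → a.1 < m ∧ a.2 < m)
    (hconn : (cellGraph w).Connected) (hbot : w (c, 0)) (htop : w (c, m - 1)) :
    ∃ p : ℕ → ℕ → ZMod 2,
      (∀ x y, x < m → y < m → ¬ w (x, y) →
        p x y = p (x + 1) y ∧ p x y = p x (y + 1) ∧ p x y = p (x + 1) (y + 1)) ∧
      (∀ y ≤ m, p 0 y = 0) ∧ (∀ y ≤ m, p m y = 1) ∧
      (∀ x ≤ m, p x 0 = if c < x then 1 else 0) ∧ (∀ x ≤ m, p x m = if c < x then 1 else 0) := by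
  obtain ⟨H, V, h1, h2, h3, h4, h5⟩ := ChainConnected.of_connected hconn hbot htop
  have hc := (hlt _ hbot).1
  simp only at hc
  -- Adding the outer sides of the two exits cancels the boundary of the chain: `H'` and `V` sum to
  -- zero round every cell of the grid.
  let H' : ℕ → ℕ → ZMod 2 := fun x y => H x y + if x = c ∧ (y = 0 ∨ y = m) then 1 else 0
  have hcell : ∀ x y, y < m → H' x y + H' x (y + 1) + V x y + V (x + 1) y = 0 := by
    intro x y hy
    have e := h5 x y
    have : (if x = c ∧ (y = 0 ∨ y = m) then (1 : ZMod 2) else 0) +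
        (if x = c ∧ (y + 1 = 0 ∨ y + 1 = m) then 1 else 0) =
        (if (c, 0) = (x, y) then 1 else 0) + (if (c, m - 1) = (x, y) then 1 else 0) := by
      simp only [Prod.mk.injEq]
      congr 1
      · congr 1; apply propext; omega
      · congr 1; apply propext; omega
    have hb := CharTwo.add_self_eq_zero (if (c, 0) = (x, y) then (1 : ZMod 2) else 0)
    have hb' := CharTwo.add_self_eq_zero (if (c, m - 1) = (x, y) then (1 : ZMod 2) else 0)
    simp only [H']
    linear_combination e + this + hb + hb'
  -- The parity of the crossings along row `y` on the way from the left border. Since the sums round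
  -- cells vanish, its vertical increments are given by `V`.
  let p : ℕ → ℕ → ZMod 2 := fun x y => ∑ i ∈ Finset.range x, H' i y
  have hpx : ∀ x y, p (x + 1) y = p x y + H' x y := fun x y => Finset.sum_range_succ _ _
  have hpy : ∀ x y, y < m → p x (y + 1) = p x y + V x y := by
    intro x y hy
    induction x with
    | zero => simp [p, h2]
    | succ x ih =>
      have e := hcell x y hy
      rw [hpx, hpx, ih]
      have hb := CharTwo.add_self_eq_zero (H' x y)
      have hb' := CharTwo.add_self_eq_zero (V (x + 1) y)
      linear_combination e - hb - hb'
  have hH0 : ∀ x, H' x 0 = if x = c then 1 else 0 := by intro x; simp [H', h1]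
  have hHm : ∀ x, H' x m = if x = c then 1 else 0 := by
    intro x
    have : H x m = 0 := by
      by_contra hne
      obtain ⟨n, rfl⟩ : ∃ n, m = n + 1 := ⟨m - 1, by omega⟩
      have := (hlt _ (h3 _ _ hne).2).2
      simp at this
    simp [H', this]
  have hVm : ∀ y, V m y = 0 := by
    intro y
    by_contra hne
    obtain ⟨n, rfl⟩ : ∃ n, m = n + 1 := ⟨m - 1, by omega⟩
    have := (hlt _ (h4 _ _ hne).2).1
    simp at this
  have hsum : ∀ x, ∑ i ∈ Finset.range x, (if i = c then (1 : ZMod 2) else 0) =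
      if c < x then 1 else 0 := by
    intro x; simp [Finset.sum_ite_eq']
  have hrow0 : ∀ x, p x 0 = if c < x then 1 else 0 := by
    intro x; simp only [p, hH0, hsum]
  refine ⟨p, fun x y hx hy hw => ?_, fun y _ => by simp [p], fun y hy => ?_, fun x _ => hrow0 x,
    fun x _ => by simp only [p, hHm, hsum]⟩
  · have e1 : H' x y = 0 := by
      have : H x y = 0 := by
        cases y with
        | zero => exact h1 x
        | succ y => by_contra hne; exact hw (h3 _ _ hne).2
      have h' : ¬ (x = c ∧ (y = 0 ∨ y = m)) := by
        rintro ⟨rfl, rfl | rfl⟩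
        · exact hw hbot
        · omega
      simp [H', this, h']
    have e2 : V x y = 0 := by
      cases x with
      | zero => exact h2 y
      | succ x => by_contra hne; exact hw (h4 _ _ hne).2
    have e3 : V (x + 1) y = 0 := by by_contra hne; exact hw (h4 _ _ hne).1
    exact ⟨by rw [hpx, e1, add_zero], by rw [hpy _ _ hy, e2, add_zero],
      by rw [hpy _ _ hy, hpx, e1, e3, add_zero, add_zero]⟩
  · induction y with
    | zero => rw [hrow0, if_pos hc]
    | succ y ih => rw [hpy _ _ (by omega), ih (by omega), hVm, add_zero]

/-- The reflection of the set of white cells in the diagonal. -/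
def cellGraphSwap (w : ℕ × ℕ → Prop) : cellGraph w ≃g cellGraph (fun a => w a.swap) where
  toFun a := ⟨a.1.swap, by simpa using a.2⟩
  invFun a := ⟨a.1.swap, a.2⟩
  left_inv a := by simp
  right_inv a := by simp
  map_rel_iff' := by
    intro a b
    simp only [cellGraph, Neighbor, Equiv.coe_fn_mk, Prod.fst_swap, Prod.snd_swap]
    omega

/-- Here `p` comes from a chain between the bottom and top exits, and `q` from one between the left
and right exits, obtained by reflecting the pattern. -/
theorem IsPattern.exists_labelling (h : IsPattern m w c r) :
    ∃ p q : ℕ → ℕ → ZMod 2,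
      (∀ x y, x < m → y < m → ¬ w (x, y) →
        (p x y = p (x + 1) y ∧ p x y = p x (y + 1) ∧ p x y = p (x + 1) (y + 1)) ∧
        (q x y = q (x + 1) y ∧ q x y = q x (y + 1) ∧ q x y = q (x + 1) (y + 1))) ∧
      (∀ y ≤ m, p 0 y = 0 ∧ p m y = 1 ∧
        (q 0 y = if r < y then 1 else 0) ∧ q m y = if r < y then 1 else 0) ∧
      (∀ x ≤ m, q x 0 = 0 ∧ q x m = 1 ∧
        (p x 0 = if c < x then 1 else 0) ∧ p x m = if c < x then 1 else 0) := by
  have hm : 0 < m := by have := h.c_lt; omega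
  obtain ⟨p, a1, a2, a3, a4, a5⟩ := QuadLabyrinth.exists_labelling hm h.lt h.tree.connected
    ((h.bottom c).2 rfl) ((h.top c).2 rfl)
  obtain ⟨q, b1, b2, b3, b4, b5⟩ := QuadLabyrinth.exists_labelling (w := fun a => w a.swap) hm
    (fun a ha => (h.lt _ ha).symm) ((cellGraphSwap w).connected_iff.1 h.tree.connected)
    ((h.left r).2 rfl) ((h.right r).2 rfl)
  refine ⟨p, fun x y => q y x, fun x y hx hy hw => ⟨a1 x y hx hy hw, ?_⟩, fun y hy =>
    ⟨a2 y hy, a3 y hy, b4 y hy, b5 y hy⟩, fun x hx => ⟨b2 x hx, b3 x hx, a4 x hx, a5 x hx⟩⟩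
  obtain ⟨e1, e2, e3⟩ := b1 y x hy hx hw
  exact ⟨e2, e1, e3⟩

end

/-! ### The labyrinth fractal in the unit square -/

section

open Set Filter Topology

variable {m c r : ℕ} {w : ℕ × ℕ → Prop}

/-- The unit square. -/
def unitSq : Set (ℝ × ℝ) := Icc 0 1 ×ˢ Icc 0 1

/-- The corners of the unit square. -/
def corner : Fin 4 → ℝ × ℝ := ![(0, 0), (1, 0), (1, 1), (0, 1)]

/-- The homothety from the unit square onto the cell `a` of the `m × m` grid. -/
noncomputable def cellMap (m : ℕ) (a : ℕ × ℕ) (z : ℝ × ℝ) : ℝ × ℝ :=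
  ((a.1 + z.1) / m, (a.2 + z.2) / m)

/-- The union of the white cells of order `n`. -/
def whiteUnion (m : ℕ) (w : ℕ × ℕ → Prop) : ℕ → Set (ℝ × ℝ)
  | 0 => unitSq
  | n + 1 => {z | ∃ a, w a ∧ ∃ z' ∈ whiteUnion m w n, cellMap m a z' = z}

/-- The labyrinth fractal in the unit square. -/
def squareFractal (m : ℕ) (w : ℕ × ℕ → Prop) : Set (ℝ × ℝ) := ⋂ n, whiteUnion m w n

theorem corner_mem (i : Fin 4) : corner i ∈ unitSq := by
  fin_cases i <;> simp [corner, unitSq]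

theorem isCompact_unitSq : IsCompact unitSq := isCompact_Icc.prod isCompact_Icc

theorem continuous_cellMap (a : ℕ × ℕ) : Continuous (cellMap m a) := by
  unfold cellMap; fun_prop

/-- Distinct closed unit intervals with integer ends meet at most in an endpoint. -/
theorem add_eq_add_cases {i j : ℕ} {s t : ℝ} (hs : s ∈ Icc (0 : ℝ) 1) (ht : t ∈ Icc (0 : ℝ) 1)
    (e : (i : ℝ) + s = j + t) :
    (i = j ∧ s = t) ∨ (j = i + 1 ∧ s = 1 ∧ t = 0) ∨ (i = j + 1 ∧ s = 0 ∧ t = 1) := by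
  obtain ⟨s0, s1⟩ := hs
  obtain ⟨t0, t1⟩ := ht
  rcases lt_trichotomy i j with h | h | h
  · have h' : (i : ℝ) + 1 ≤ j := by exact_mod_cast h
    refine Or.inr (Or.inl ⟨?_, by linarith, by linarith⟩)
    have : (j : ℝ) = (i + 1 : ℕ) := by push_cast; linarith
    exact_mod_cast this
  · subst h; exact Or.inl ⟨rfl, by linarith⟩
  · have h' : (j : ℝ) + 1 ≤ i := by exact_mod_cast h
    refine Or.inr (Or.inr ⟨?_, by linarith, by linarith⟩)
    have : (i : ℝ) = (j + 1 : ℕ) := by push_cast; linarith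
    exact_mod_cast this

theorem cellMap_eq_cellMap (hm : 0 < m) {a b : ℕ × ℕ} {z z' : ℝ × ℝ}
    (e : cellMap m a z = cellMap m b z') :
    (a.1 : ℝ) + z.1 = b.1 + z'.1 ∧ (a.2 : ℝ) + z.2 = b.2 + z'.2 := by
  have hm' : (m : ℝ) ≠ 0 := by positivity
  simp only [cellMap, Prod.mk.injEq] at e
  rwa [div_left_inj' hm', div_left_inj' hm'] at e

theorem cellMap_injective (hm : 0 < m) (a : ℕ × ℕ) : Function.Injective (cellMap m a) := by
  intro z z' e
  obtain ⟨h1, h2⟩ := cellMap_eq_cellMap hm e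
  exact Prod.ext (by linarith) (by linarith)

theorem div_mem_Icc {i : ℕ} (hi : i < m) {s : ℝ} (hs : s ∈ Icc (0 : ℝ) 1) :
    (i + s) / m ∈ Icc (0 : ℝ) 1 := by
  have h : (i : ℝ) + 1 ≤ m := by exact_mod_cast hi
  have hm' : (0 : ℝ) < m := by have := Nat.cast_nonneg (α := ℝ) i; linarith
  obtain ⟨s0, s1⟩ := hs
  exact ⟨by positivity, by rw [div_le_one hm']; linarith⟩

theorem cellMap_mem {a : ℕ × ℕ} (h1 : a.1 < m) (h2 : a.2 < m) {z : ℝ × ℝ} (hz : z ∈ unitSq) :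
    cellMap m a z ∈ unitSq :=
  ⟨div_mem_Icc h1 hz.1, div_mem_Icc h2 hz.2⟩

/-- The index of the part of `[0, 1]` containing `t`. -/
noncomputable def digit (m : ℕ) (t : ℝ) : ℕ := min ⌊m * t⌋₊ (m - 1)

theorem digit_lt (hm : 0 < m) (t : ℝ) : digit m t < m := by
  unfold digit; omega

theorem sub_digit_mem (hm : 0 < m) {t : ℝ} (ht : t ∈ Icc (0 : ℝ) 1) :
    m * t - digit m t ∈ Icc (0 : ℝ) 1 := by
  obtain ⟨t0, t1⟩ := ht
  have hmt : 0 ≤ m * t := by positivity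
  have h1 := Nat.floor_le hmt
  have h2 := Nat.lt_floor_add_one (m * t)
  unfold digit
  rcases le_total ⌊m * t⌋₊ (m - 1) with h | h
  · rw [min_eq_left h]
    exact ⟨by linarith, by linarith⟩
  · rw [min_eq_right h]
    have h3 : ((m - 1 : ℕ) : ℝ) ≤ ⌊m * t⌋₊ := by exact_mod_cast h
    have h4 : ((m - 1 : ℕ) : ℝ) = m - 1 := by
      rw [Nat.cast_sub (by omega)]; simp
    refine ⟨by linarith, ?_⟩
    have : (m : ℝ) * t ≤ m := by nlinarith [Nat.cast_nonneg (α := ℝ) m]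
    linarith

/-- A cell containing `z`. -/
noncomputable def cellOf (m : ℕ) (z : ℝ × ℝ) : ℕ × ℕ := (digit m z.1, digit m z.2)

/-- The preimage of `z` under the homothety of the cell `a`. -/
noncomputable def cellInv (m : ℕ) (a : ℕ × ℕ) (z : ℝ × ℝ) : ℝ × ℝ :=
  (m * z.1 - a.1, m * z.2 - a.2)

theorem continuous_cellInv (a : ℕ × ℕ) : Continuous (cellInv m a) := by
  unfold cellInv; fun_prop

theorem cellMap_cellInv (hm : 0 < m) (a : ℕ × ℕ) (z : ℝ × ℝ) : cellMap m a (cellInv m a z) = z := by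
  have hm' : (m : ℝ) ≠ 0 := by positivity
  apply Prod.ext <;> simp only [cellMap, cellInv] <;> field_simp <;> ring

theorem cellInv_cellMap (hm : 0 < m) (a : ℕ × ℕ) (z : ℝ × ℝ) : cellInv m a (cellMap m a z) = z :=
  cellMap_injective hm a (cellMap_cellInv hm a _)

theorem cellInv_cellOf_mem (hm : 0 < m) {z : ℝ × ℝ} (hz : z ∈ unitSq) :
    cellInv m (cellOf m z) z ∈ unitSq :=
  ⟨sub_digit_mem hm hz.1, sub_digit_mem hm hz.2⟩

theorem exists_cell (hm : 0 < m) {z : ℝ × ℝ} (hz : z ∈ unitSq) :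
    ∃ a : ℕ × ℕ, a.1 < m ∧ a.2 < m ∧ ∃ z' ∈ unitSq, cellMap m a z' = z :=
  ⟨cellOf m z, digit_lt hm _, digit_lt hm _, _, cellInv_cellOf_mem hm hz, cellMap_cellInv hm _ _⟩

theorem exists_digit (hm : 0 < m) {t : ℝ} (ht : t ∈ Icc (0 : ℝ) 1) :
    ∃ j < m, ∃ s ∈ Icc (0 : ℝ) 1, (j + s) / m = t := by
  have hm' : (m : ℝ) ≠ 0 := by positivity
  exact ⟨digit m t, digit_lt hm t, _, sub_digit_mem hm ht, by field_simp; ring⟩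

namespace IsPattern

theorem m_pos (h : IsPattern m w c r) : 0 < m := by have := h.c_lt; omega

theorem whiteUnion_subset (h : IsPattern m w c r) (n : ℕ) : whiteUnion m w n ⊆ unitSq := by
  induction n with
  | zero => exact subset_rfl
  | succ n ih =>
    rintro _ ⟨a, ha, z, hz, rfl⟩
    exact cellMap_mem (h.lt a ha).1 (h.lt a ha).2 (ih hz)

theorem whiteUnion_succ_subset (h : IsPattern m w c r) (n : ℕ) :
    whiteUnion m w (n + 1) ⊆ whiteUnion m w n := by
  induction n with
  | zero => exact h.whiteUnion_subset 1
  | succ n ih =>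
    rintro _ ⟨a, ha, z, hz, rfl⟩
    exact ⟨a, ha, z, ih hz, rfl⟩

theorem whiteUnion_antitone (h : IsPattern m w c r) : Antitone (whiteUnion m w) :=
  antitone_nat_of_succ_le h.whiteUnion_succ_subset

theorem isCompact_whiteUnion (h : IsPattern m w c r) (n : ℕ) : IsCompact (whiteUnion m w n) := by
  induction n with
  | zero => exact isCompact_unitSq
  | succ n ih =>
    have : whiteUnion m w (n + 1) = ⋃ a ∈ {a | w a}, cellMap m a '' whiteUnion m w n := by
      ext z; simp [whiteUnion]
    rw [this]
    have hf : {a | w a}.Finite := h.finite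
    exact hf.isCompact_biUnion fun a _ => ih.image (continuous_cellMap a)

theorem cellMap_left {j : ℕ} {s : ℝ} :
    cellMap m (0, j) (0, s) = (0, (j + s) / m) := by simp [cellMap]

theorem cellMap_right (hm : 0 < m) {j : ℕ} {s : ℝ} :
    cellMap m (m - 1, j) (1, s) = (1, (j + s) / m) := by
  have hm' : (m : ℝ) ≠ 0 := by positivity
  simp [cellMap, Nat.cast_sub (show 1 ≤ m by omega), hm']

theorem cellMap_bottom {j : ℕ} {s : ℝ} :
    cellMap m (j, 0) (s, 0) = ((j + s) / m, 0) := by simp [cellMap]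

theorem cellMap_top (hm : 0 < m) {j : ℕ} {s : ℝ} :
    cellMap m (j, m - 1) (s, 1) = ((j + s) / m, 1) := by
  have hm' : (m : ℝ) ≠ 0 := by positivity
  simp [cellMap, Nat.cast_sub (show 1 ≤ m by omega), hm']

theorem eq_zero_of_div (hm : 0 < m) {i : ℕ} {s : ℝ} (hs : s ∈ Icc (0 : ℝ) 1)
    (e : (i + s) / m = 0) : i = 0 ∧ s = 0 := by
  have hm' : (m : ℝ) ≠ 0 := by positivity
  have : (i : ℝ) + s = 0 := by simpa [hm'] using e
  have hi := Nat.cast_nonneg (α := ℝ) i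
  have : (i : ℝ) = 0 := by linarith [hs.1]
  exact ⟨by exact_mod_cast this, by linarith⟩

theorem eq_one_of_div (hm : 0 < m) {i : ℕ} (hi : i < m) {s : ℝ} (hs : s ∈ Icc (0 : ℝ) 1)
    (e : (i + s) / m = 1) : i = m - 1 ∧ s = 1 := by
  have hm' : (m : ℝ) ≠ 0 := by positivity
  have e' : (i : ℝ) + s = m := by rwa [div_eq_one_iff_eq hm'] at e
  have hi' : (i : ℝ) + 1 ≤ m := by exact_mod_cast hi
  have : (m : ℝ) = (i + 1 : ℕ) := by push_cast; linarith [hs.2]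
  have : m = i + 1 := by exact_mod_cast this
  exact ⟨by omega, by linarith [hs.2]⟩

/-- Opposite exits lie in the same row or column, so by induction the white cells leave the same
trace on opposite sides at every order. -/
theorem sides (h : IsPattern m w c r) (n : ℕ) (t : ℝ) :
    ((0, t) ∈ whiteUnion m w n ↔ (1, t) ∈ whiteUnion m w n) ∧
    ((t, 0) ∈ whiteUnion m w n ↔ (t, 1) ∈ whiteUnion m w n) := by
  have hm := h.m_pos
  induction n generalizing t with
  | zero => simp [whiteUnion, unitSq]
  | succ n ih =>
    refine ⟨⟨?_, ?_⟩, ⟨?_, ?_⟩⟩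
    · rintro ⟨⟨i, j⟩, ha, ⟨s, s'⟩, hz, e⟩
      obtain ⟨e1, e2⟩ := Prod.mk.inj e
      obtain ⟨rfl, rfl⟩ := eq_zero_of_div hm (h.whiteUnion_subset n hz).1 e1
      refine ⟨(m - 1, j), (h.right j).2 ((h.left j).1 ha), (1, s'), (ih s').1.1 hz, ?_⟩
      rw [cellMap_right hm, ← e2]
    · rintro ⟨⟨i, j⟩, ha, ⟨s, s'⟩, hz, e⟩
      obtain ⟨e1, e2⟩ := Prod.mk.inj e
      obtain ⟨rfl, rfl⟩ := eq_one_of_div hm (h.lt _ ha).1 (h.whiteUnion_subset n hz).1 e1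
      refine ⟨(0, j), (h.left j).2 ((h.right j).1 ha), (0, s'), (ih s').1.2 hz, ?_⟩
      rw [cellMap_left, ← e2]
    · rintro ⟨⟨i, j⟩, ha, ⟨s, s'⟩, hz, e⟩
      obtain ⟨e1, e2⟩ := Prod.mk.inj e
      obtain ⟨rfl, rfl⟩ := eq_zero_of_div hm (h.whiteUnion_subset n hz).2 e2
      refine ⟨(i, m - 1), (h.top i).2 ((h.bottom i).1 ha), (s, 1), (ih s).2.1 hz, ?_⟩
      rw [cellMap_top hm, ← e1]
    · rintro ⟨⟨i, j⟩, ha, ⟨s, s'⟩, hz, e⟩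
      obtain ⟨e1, e2⟩ := Prod.mk.inj e
      obtain ⟨rfl, rfl⟩ := eq_one_of_div hm (h.lt _ ha).2 (h.whiteUnion_subset n hz).2 e2
      refine ⟨(i, 0), (h.bottom i).2 ((h.top i).1 ha), (s, 0), (ih s).2.2 hz, ?_⟩
      rw [cellMap_bottom, ← e1]

theorem corner_notMem (h : IsPattern m w c r) {s t : ℝ} (hs : s = 0 ∨ s = 1) (ht : t = 0 ∨ t = 1) :
    (s, t) ∉ whiteUnion m w 1 := by
  have hm := h.m_pos
  have h1 := h.c_pos
  have h2 := h.c_lt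
  rintro ⟨⟨i, j⟩, ha, ⟨s', t'⟩, hz, e⟩
  obtain ⟨e1, e2⟩ := Prod.mk.inj e
  have hi : i = 0 ∨ i = m - 1 := by
    rcases hs with rfl | rfl
    · exact Or.inl (eq_zero_of_div hm hz.1 e1).1
    · exact Or.inr (eq_one_of_div hm (h.lt _ ha).1 hz.1 e1).1
  have hj : j = 0 ∨ j = m - 1 := by
    rcases ht with rfl | rfl
    · exact Or.inl (eq_zero_of_div hm hz.2 e2).1
    · exact Or.inr (eq_one_of_div hm (h.lt _ ha).2 hz.2 e2).1
  have : i = c := by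
    rcases hj with rfl | rfl
    · exact (h.bottom i).1 ha
    · exact (h.top i).1 ha
  omega

theorem corner_notMem_succ (h : IsPattern m w c r) {s t : ℝ} (hs : s = 0 ∨ s = 1)
    (ht : t = 0 ∨ t = 1) (n : ℕ) : (s, t) ∉ whiteUnion m w (n + 1) :=
  fun hmem => h.corner_notMem hs ht (h.whiteUnion_antitone (by omega) hmem)

/-- A point on the border of `a` may be covered through another white cell `b`. If the cells share a
side, the preimage in `b` lies on the opposite side of the square, where `sides` applies; if they
share only a vertex, the preimage is a corner, and corners are excluded from order 1 on. -/
theorem cellMap_mem_succ_iff (h : IsPattern m w c r) {a : ℕ × ℕ} (ha : w a) {z : ℝ × ℝ}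
    (hz : z ∈ unitSq) (n : ℕ) :
    cellMap m a z ∈ whiteUnion m w (n + 1) ↔ z ∈ whiteUnion m w n := by
  refine ⟨?_, fun h' => ⟨a, ha, z, h', rfl⟩⟩
  rintro ⟨b, hb, z', hz', e⟩
  cases n with
  | zero => exact hz
  | succ n =>
    obtain ⟨e1, e2⟩ := cellMap_eq_cellMap h.m_pos e
    have hz'q := h.whiteUnion_subset _ hz'
    obtain ⟨x, y⟩ := z
    obtain ⟨x', y'⟩ := z'
    have c1 := add_eq_add_cases hz'q.1 hz.1 e1
    have c2 := add_eq_add_cases hz'q.2 hz.2 e2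
    simp only at c1 c2
    rcases c1 with ⟨-, rfl⟩ | c1
    · rcases c2 with ⟨-, rfl⟩ | ⟨-, rfl, rfl⟩ | ⟨-, rfl, rfl⟩
      · exact hz'
      · exact (h.sides _ _).2.2 hz'
      · exact (h.sides _ _).2.1 hz'
    · rcases c2 with ⟨-, rfl⟩ | c2
      · rcases c1 with ⟨-, rfl, rfl⟩ | ⟨-, rfl, rfl⟩
        · exact (h.sides _ _).1.2 hz'
        · exact (h.sides _ _).1.1 hz'
      · exact absurd hz' (h.corner_notMem_succ (by tauto) (by tauto) n)

theorem cellMap_mem_squareFractal_iff (h : IsPattern m w c r) {a : ℕ × ℕ} (ha : w a) {z : ℝ × ℝ}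
    (hz : z ∈ unitSq) : cellMap m a z ∈ squareFractal m w ↔ z ∈ squareFractal m w := by
  simp only [squareFractal, mem_iInter]
  refine ⟨fun h' n => (h.cellMap_mem_succ_iff ha hz n).1 (h' _), fun h' n => ?_⟩
  exact h.whiteUnion_succ_subset n ((h.cellMap_mem_succ_iff ha hz n).2 (h' n))

/-- The preimage of a lattice point in any white cell is a corner of the square, and corners are
excluded at order 1; so order 2 excludes lattice points. -/
theorem lattice_notMem (h : IsPattern m w c r) (i j : ℕ) :
    ((i / m : ℝ), (j / m : ℝ)) ∉ squareFractal m w := by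
  intro hmem
  have hm' : (m : ℝ) ≠ 0 := by have := h.m_pos; positivity
  obtain ⟨a, ha, ⟨s, t⟩, hz, e⟩ := mem_iInter.1 hmem 2
  obtain ⟨e1, e2⟩ := Prod.mk.inj e
  rw [div_left_inj' hm'] at e1 e2
  have hzq := h.whiteUnion_subset _ hz
  have z0 : (0 : ℝ) ∈ Icc (0 : ℝ) 1 := by simp
  have c1 := add_eq_add_cases (j := i) hzq.1 z0 (by simpa using e1)
  have c2 := add_eq_add_cases (j := j) hzq.2 z0 (by simpa using e2)
  simp only at c1 c2
  exact h.corner_notMem (by tauto) (by tauto) hz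

theorem interior_notMem (h : IsPattern m w c r) {a : ℕ × ℕ} (ha : ¬ w a) {z : ℝ × ℝ}
    (hz : z ∈ Ioo (0 : ℝ) 1 ×ˢ Ioo (0 : ℝ) 1) : cellMap m a z ∉ squareFractal m w := by
  intro hmem
  obtain ⟨b, hb, z', hz', e⟩ := mem_iInter.1 hmem 1
  obtain ⟨e1, e2⟩ := cellMap_eq_cellMap h.m_pos e
  obtain ⟨⟨a1, a2⟩, a3, a4⟩ := hz
  have c1 := add_eq_add_cases hz'.1 ⟨a1.le, a2.le⟩ e1
  have c2 := add_eq_add_cases hz'.2 ⟨a3.le, a4.le⟩ e2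
  have h1 : b.1 = a.1 := by
    rcases c1 with c1 | c1 | c1
    · exact c1.1
    · linarith [c1.2.2]
    · linarith [c1.2.2]
  have h2 : b.2 = a.2 := by
    rcases c2 with c2 | c2 | c2
    · exact c2.1
    · linarith [c2.2.2]
    · linarith [c2.2.2]
  exact ha (Prod.ext h1 h2 ▸ hb)

/-- The open cell is connected and misses the fractal; the rest of the set lies in its closure. -/
theorem isPreconnected_black (h : IsPattern m w c r) {a : ℕ × ℕ} (ha : ¬ w a) :
    IsPreconnected (cellMap m a '' unitSq \ squareFractal m w) := by
  have hconv : Convex ℝ (Ioo (0 : ℝ) 1 ×ˢ Ioo (0 : ℝ) 1) := (convex_Ioo 0 1).prod (convex_Ioo 0 1)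
  have hpre := hconv.isPreconnected.image (cellMap m a) (continuous_cellMap a).continuousOn
  refine hpre.subset_closure ?_ ?_
  · rintro _ ⟨z, hz, rfl⟩
    exact ⟨⟨z, ⟨Ioo_subset_Icc_self hz.1, Ioo_subset_Icc_self hz.2⟩, rfl⟩, h.interior_notMem ha hz⟩
  · refine sdiff_subset.trans ?_
    refine Subset.trans ?_ (image_closure_subset_closure_image (continuous_cellMap a))
    rw [closure_prod_eq, closure_Ioo zero_ne_one, unitSq]

end IsPattern

/-- `x` and `y` lie in a connected subset of `X`. -/
def ConnectedIn {E : Type*} [TopologicalSpace E] (X : Set E) (x y : E) : Prop :=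
  ∃ s ⊆ X, IsPreconnected s ∧ x ∈ s ∧ y ∈ s

theorem ConnectedIn.trans {E : Type*} [TopologicalSpace E] {X : Set E} {x y z : E}
    (h : ConnectedIn X x y) (h' : ConnectedIn X y z) : ConnectedIn X x z := by
  obtain ⟨s, hs, ps, hx, hy⟩ := h
  obtain ⟨t, ht, pt, hy', hz⟩ := h'
  exact ⟨s ∪ t, union_subset hs ht, ps.union y hy hy' pt, Or.inl hx, Or.inr hz⟩

namespace IsPattern

theorem corner_notMem_squareFractal (h : IsPattern m w c r) (i : Fin 4) :
    corner i ∉ squareFractal m w := by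
  intro hmem
  have h1 := mem_iInter.1 hmem 1
  fin_cases i <;> exact h.corner_notMem (by simp) (by simp) h1

theorem connectedIn_black (h : IsPattern m w c r) {a : ℕ × ℕ} (h1 : a.1 < m) (h2 : a.2 < m)
    (ha : ¬ w a) {z z' : ℝ × ℝ} (hz : z ∈ cellMap m a '' unitSq) (hz' : z' ∈ cellMap m a '' unitSq)
    (hzK : z ∉ squareFractal m w) (hzK' : z' ∉ squareFractal m w) :
    ConnectedIn (unitSq \ squareFractal m w) z z' := by
  refine ⟨_, sdiff_subset_sdiff_left ?_, h.isPreconnected_black ha, ⟨hz, hzK⟩, ⟨hz', hzK'⟩⟩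
  rintro _ ⟨z, hz, rfl⟩
  exact cellMap_mem h1 h2 hz

theorem lattice_mem_cell {i j i' j' : ℕ} (hi : i' = i ∨ i' = i + 1) (hj : j' = j ∨ j' = j + 1) :
    ((i' / m : ℝ), (j' / m : ℝ)) ∈ cellMap m (i, j) '' unitSq := by
  refine ⟨((i' : ℝ) - i, (j' : ℝ) - j), ⟨?_, ?_⟩, by simp [cellMap]⟩
  · rcases hi with rfl | rfl <;> simp
  · rcases hj with rfl | rfl <;> simp

/-- Black cells connect their vertices with each other, so being connected to some corner is a
property to which `forall_lattice` applies. -/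
theorem lattice_connectedIn_corner (h : IsPattern m w c r) (i j : ℕ) (hi : i ≤ m) (hj : j ≤ m) :
    ∃ k, ConnectedIn (unitSq \ squareFractal m w) ((i / m : ℝ), (j / m : ℝ)) (corner k) := by
  have hm' : (m : ℝ) ≠ 0 := by have := h.m_pos; positivity
  have hrefl : ∀ k, ConnectedIn (unitSq \ squareFractal m w) (corner k) (corner k) := fun k =>
    ⟨{corner k}, by simpa using ⟨corner_mem k, h.corner_notMem_squareFractal k⟩,
      isPreconnected_singleton, rfl, rfl⟩
  refine h.forall_lattice (fun v => ∃ k, ConnectedIn (unitSq \ squareFractal m w)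
    ((v.1 / m : ℝ), (v.2 / m : ℝ)) (corner k)) ?_ ?_ ?_ ?_ ?_ i j hi hj
  · intro x y hx hy hw
    have key : ∀ x₁ y₁ x₂ y₂ : ℕ, (x₁ = x ∨ x₁ = x + 1) → (y₁ = y ∨ y₁ = y + 1) →
        (x₂ = x ∨ x₂ = x + 1) → (y₂ = y ∨ y₂ = y + 1) →
        (∃ k, ConnectedIn (unitSq \ squareFractal m w) ((x₁ / m : ℝ), (y₁ / m : ℝ)) (corner k)) →
        ∃ k, ConnectedIn (unitSq \ squareFractal m w) ((x₂ / m : ℝ), (y₂ / m : ℝ)) (corner k) := by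
      rintro x₁ y₁ x₂ y₂ a1 a2 a3 a4 ⟨k, hk⟩
      exact ⟨k, (h.connectedIn_black hx hy hw (lattice_mem_cell a3 a4) (lattice_mem_cell a1 a2)
        (h.lattice_notMem _ _) (h.lattice_notMem _ _)).trans hk⟩
    refine ⟨⟨?_, ?_⟩, ⟨?_, ?_⟩, ⟨?_, ?_⟩⟩ <;> apply key <;> simp
  · exact ⟨0, by simpa [corner] using hrefl 0⟩
  · exact ⟨1, by simpa [corner, hm'] using hrefl 1⟩
  · exact ⟨3, by simpa [corner, hm'] using hrefl 3⟩
  · exact ⟨2, by simpa [corner, hm'] using hrefl 2⟩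

/-- In a white cell the homothety carries the connection found at the lower order to one ending at a
vertex of the cell, and it respects the fractal by `cellMap_mem_squareFractal_iff`. In a black cell
a vertex is reached directly. -/
theorem connectedIn_corner_of_notMem (h : IsPattern m w c r) (n : ℕ) {z : ℝ × ℝ} (hz : z ∈ unitSq)
    (hn : z ∉ whiteUnion m w n) :
    ∃ k, ConnectedIn (unitSq \ squareFractal m w) z (corner k) := by
  induction n generalizing z with
  | zero => exact absurd hz hn
  | succ n ih =>
    obtain ⟨⟨i, j⟩, h1, h2, z', hz', rfl⟩ := exists_cell h.m_pos hz
    by_cases ha : w (i, j)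
    · have hn' : z' ∉ whiteUnion m w n := fun h' => hn ⟨_, ha, z', h', rfl⟩
      obtain ⟨k, s, hs, hsc, hzs, hks⟩ := ih hz' hn'
      have himg : ConnectedIn (unitSq \ squareFractal m w) (cellMap m (i, j) z')
          (cellMap m (i, j) (corner k)) := by
        refine ⟨cellMap m (i, j) '' s, ?_, hsc.image _ (continuous_cellMap _).continuousOn,
          mem_image_of_mem _ hzs, mem_image_of_mem _ hks⟩
        rintro _ ⟨y, hy, rfl⟩
        have hy' := hs hy
        exact ⟨cellMap_mem h1 h2 hy'.1, fun hK =>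
          hy'.2 ((h.cellMap_mem_squareFractal_iff ha hy'.1).1 hK)⟩
      have hlat : ∃ i' j' : ℕ, i' ≤ m ∧ j' ≤ m ∧
          cellMap m (i, j) (corner k) = ((i' / m : ℝ), (j' / m : ℝ)) := by
        simp only at h1 h2
        fin_cases k
        · exact ⟨i, j, by omega, by omega, by simp [cellMap, corner]⟩
        · exact ⟨i + 1, j, by omega, by omega, by simp [cellMap, corner]⟩
        · exact ⟨i + 1, j + 1, by omega, by omega, by simp [cellMap, corner]⟩
        · exact ⟨i, j + 1, by omega, by omega, by simp [cellMap, corner]⟩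
      obtain ⟨i', j', hi', hj', e⟩ := hlat
      rw [e] at himg
      obtain ⟨k', hk'⟩ := h.lattice_connectedIn_corner i' j' hi' hj'
      exact ⟨k', himg.trans hk'⟩
    · obtain ⟨k, hk⟩ := h.lattice_connectedIn_corner i j (le_of_lt h1) (le_of_lt h2)
      refine ⟨k, (h.connectedIn_black h1 h2 ha ⟨z', hz', rfl⟩
        (lattice_mem_cell (.inl rfl) (.inl rfl)) (fun hK => hn (mem_iInter.1 hK _))
        (h.lattice_notMem _ _)).trans hk⟩

theorem connectedIn_corner (h : IsPattern m w c r) {z : ℝ × ℝ}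
    (hz : z ∈ unitSq \ squareFractal m w) :
    ∃ k, ConnectedIn (unitSq \ squareFractal m w) z (corner k) := by
  have := hz.2
  simp only [squareFractal, mem_iInter, not_forall] at this
  obtain ⟨n, hn⟩ := this
  exact h.connectedIn_corner_of_notMem n hz.1 hn

end IsPattern

end

/-! ### A locally constant function separating the corners -/

section

open Set Filter Topology

variable {m c r : ℕ} {w : ℕ × ℕ → Prop}

/-- The label of the vertex of the cell `a` in the direction `e`. -/
def vertexLabel (p q : ℕ → ℕ → ZMod 2) (a : ℕ × ℕ) (e : ZMod 2 × ZMod 2) : ZMod 2 × ZMod 2 :=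
  (p (a.1 + e.1.val) (a.2 + e.2.val), q (a.1 + e.1.val) (a.2 + e.2.val))

open Classical in
/-- The corner to which a point outside the white cells of order `n` is connected. -/
noncomputable def label (m : ℕ) (w : ℕ × ℕ → Prop) (p q : ℕ → ℕ → ZMod 2) :
    ℕ → ℝ × ℝ → ZMod 2 × ZMod 2
  -- An arbitrary value: no point of the square lies outside the white set of order 0.
  | 0, _ => 0
  -- A white cell passes on the label of the vertex to which the point is connected; in a black cell
  -- all vertices have the same label, so the direction `0` is as good as any.
  | n + 1, z => vertexLabel p q (cellOf m z)
      (if w (cellOf m z) then label m w p q n (cellInv m (cellOf m z) z) else 0)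

open Classical in
/-- The value of `label` of order `n + 1`, computed in the cell `a`. -/
noncomputable def cellLabel (m : ℕ) (w : ℕ × ℕ → Prop) (p q : ℕ → ℕ → ZMod 2) (n : ℕ)
    (a : ℕ × ℕ) (z : ℝ × ℝ) : ZMod 2 × ZMod 2 :=
  vertexLabel p q a (if w a then label m w p q n z else 0)

/-- The pair `(p, q)` is a labelling of the lattice points by the corners of the grid. -/
structure IsLabelling (m : ℕ) (w : ℕ × ℕ → Prop) (c r : ℕ) (p q : ℕ → ℕ → ZMod 2) : Prop where
  black : ∀ x y, x < m → y < m → ¬ w (x, y) →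
    (p x y = p (x + 1) y ∧ p x y = p x (y + 1) ∧ p x y = p (x + 1) (y + 1)) ∧
    (q x y = q (x + 1) y ∧ q x y = q x (y + 1) ∧ q x y = q (x + 1) (y + 1))
  vert : ∀ y ≤ m, p 0 y = 0 ∧ p m y = 1 ∧
    (q 0 y = if r < y then 1 else 0) ∧ q m y = if r < y then 1 else 0
  horiz : ∀ x ≤ m, q x 0 = 0 ∧ q x m = 1 ∧
    (p x 0 = if c < x then 1 else 0) ∧ p x m = if c < x then 1 else 0

variable {p q : ℕ → ℕ → ZMod 2}

theorem val_eq_zero_or_one (e : ZMod 2) : e.val = 0 ∨ e.val = 1 := by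
  have := ZMod.val_lt e
  omega

theorem IsLabelling.vertexLabel_black (hl : IsLabelling m w c r p q) {a : ℕ × ℕ} (h1 : a.1 < m)
    (h2 : a.2 < m) (ha : ¬ w a) (e e' : ZMod 2 × ZMod 2) :
    vertexLabel p q a e = vertexLabel p q a e' := by
  obtain ⟨⟨a1, a2, a3⟩, b1, b2, b3⟩ := hl.black a.1 a.2 h1 h2 ha
  have : ∀ e, vertexLabel p q a e = (p a.1 a.2, q a.1 a.2) := by
    intro e
    unfold vertexLabel
    rcases val_eq_zero_or_one e.1 with h | h <;> rcases val_eq_zero_or_one e.2 with h' | h' <;>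
      rw [h, h'] <;> simp [← a1, ← a2, ← a3, ← b1, ← b2, ← b3]
  rw [this, this]

/-- On opposite sides of the square the labels differ only in one component. -/
def SideLabels (m : ℕ) (w : ℕ × ℕ → Prop) (p q : ℕ → ℕ → ZMod 2) (n : ℕ) : Prop :=
  ∀ t ∈ Icc (0 : ℝ) 1,
    ((0, t) ∉ whiteUnion m w n →
      ∃ b, label m w p q n (0, t) = (0, b) ∧ label m w p q n (1, t) = (1, b)) ∧
    ((t, 0) ∉ whiteUnion m w n →
      ∃ b, label m w p q n (t, 0) = (b, 0) ∧ label m w p q n (t, 1) = (b, 1))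

namespace IsPattern

/-- If one of the cells is white, `SideLabels` assigns the directions `(1, b)` and `(0, b)` to the
point seen from the two cells, and these are the same lattice vertex. A black cell has one label at
all its vertices, hence also at this one. -/
theorem cellLabel_horiz (h : IsPattern m w c r) (hl : IsLabelling m w c r p q) {n : ℕ}
    (hs : SideLabels m w p q n) {i j : ℕ} (hi : i + 1 < m) (hj : j < m) {t : ℝ}
    (ht : t ∈ Icc (0 : ℝ) 1) (hn : cellMap m (i, j) (1, t) ∉ whiteUnion m w (n + 1)) :
    cellLabel m w p q n (i, j) (1, t) = cellLabel m w p q n (i + 1, j) (0, t) := by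
  have hn' : cellMap m (i + 1, j) (0, t) ∉ whiteUnion m w (n + 1) := by
    simpa [cellMap] using hn
  have hv1 : (1 : ZMod 2).val = 1 := rfl
  by_cases ha : w (i, j)
  · have h0 : (0, t) ∉ whiteUnion m w n := by
      rw [(h.sides n t).1]; exact fun h' => hn ⟨_, ha, _, h', rfl⟩
    obtain ⟨b, e0, e1⟩ := (hs t ht).1 h0
    have e : vertexLabel p q (i, j) (1, b) = vertexLabel p q (i + 1, j) (0, b) := by
      simp [vertexLabel, hv1]
    by_cases hb : w (i + 1, j)
    · simp only [cellLabel, ha, hb, if_true, e0, e1, e]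
    · simp only [cellLabel, ha, hb, if_true, if_false, e1, e]
      exact hl.vertexLabel_black hi hj hb _ _
  · by_cases hb : w (i + 1, j)
    · have h0 : (0, t) ∉ whiteUnion m w n := fun h' => hn' ⟨_, hb, _, h', rfl⟩
      obtain ⟨b, e0, e1⟩ := (hs t ht).1 h0
      have e : vertexLabel p q (i, j) (1, b) = vertexLabel p q (i + 1, j) (0, b) := by
        simp [vertexLabel, hv1]
      simp only [cellLabel, ha, hb, if_true, if_false, e0, ← e]
      exact hl.vertexLabel_black (by simp only; omega) hj ha _ _
    · have e : vertexLabel p q (i, j) (1, 0) = vertexLabel p q (i + 1, j) 0 := by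
        simp [vertexLabel, hv1]
      simp only [cellLabel, ha, hb, if_false, ← e]
      exact hl.vertexLabel_black (by simp only; omega) hj ha _ _

theorem cellLabel_vert (h : IsPattern m w c r) (hl : IsLabelling m w c r p q) {n : ℕ}
    (hs : SideLabels m w p q n) {i j : ℕ} (hi : i < m) (hj : j + 1 < m) {t : ℝ}
    (ht : t ∈ Icc (0 : ℝ) 1) (hn : cellMap m (i, j) (t, 1) ∉ whiteUnion m w (n + 1)) :
    cellLabel m w p q n (i, j) (t, 1) = cellLabel m w p q n (i, j + 1) (t, 0) := by
  have hn' : cellMap m (i, j + 1) (t, 0) ∉ whiteUnion m w (n + 1) := by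
    simpa [cellMap] using hn
  have hv1 : (1 : ZMod 2).val = 1 := rfl
  by_cases ha : w (i, j)
  · have h0 : (t, 0) ∉ whiteUnion m w n := by
      rw [(h.sides n t).2]; exact fun h' => hn ⟨_, ha, _, h', rfl⟩
    obtain ⟨b, e0, e1⟩ := (hs t ht).2 h0
    have e : vertexLabel p q (i, j) (b, 1) = vertexLabel p q (i, j + 1) (b, 0) := by
      simp [vertexLabel, hv1]
    by_cases hb : w (i, j + 1)
    · simp only [cellLabel, ha, hb, if_true, e0, e1, e]
    · simp only [cellLabel, ha, hb, if_true, if_false, e1, e]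
      exact hl.vertexLabel_black hi hj hb _ _
  · by_cases hb : w (i, j + 1)
    · have h0 : (t, 0) ∉ whiteUnion m w n := fun h' => hn' ⟨_, hb, _, h', rfl⟩
      obtain ⟨b, e0, e1⟩ := (hs t ht).2 h0
      have e : vertexLabel p q (i, j) (b, 1) = vertexLabel p q (i, j + 1) (b, 0) := by
        simp [vertexLabel, hv1]
      simp only [cellLabel, ha, hb, if_true, if_false, e0, ← e]
      exact hl.vertexLabel_black hi (by simp only; omega) ha _ _
    · have e : vertexLabel p q (i, j) (0, 1) = vertexLabel p q (i, j + 1) 0 := by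
        simp [vertexLabel, hv1]
      simp only [cellLabel, ha, hb, if_false, ← e]
      exact hl.vertexLabel_black hi (by simp only; omega) ha _ _

/-- The cells are compared through the intermediate cell `(i', j)`, so only common sides matter,
even when the cells meet in a vertex. This makes the choice of cell in `cellOf` harmless. -/
theorem cellLabel_congr (h : IsPattern m w c r) (hl : IsLabelling m w c r p q) {n : ℕ}
    (hs : SideLabels m w p q n) {a b : ℕ × ℕ} (ha : a.1 < m ∧ a.2 < m) (hb : b.1 < m ∧ b.2 < m)
    {z z' : ℝ × ℝ} (hz : z ∈ unitSq) (hz' : z' ∈ unitSq) (e : cellMap m a z = cellMap m b z')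
    (hn : cellMap m a z ∉ whiteUnion m w (n + 1)) :
    cellLabel m w p q n a z = cellLabel m w p q n b z' := by
  obtain ⟨i, j⟩ := a
  obtain ⟨i', j'⟩ := b
  obtain ⟨s, t⟩ := z
  obtain ⟨s', t'⟩ := z'
  obtain ⟨e1, e2⟩ := cellMap_eq_cellMap h.m_pos e
  simp only at e1 e2 ha hb
  have hmid : cellMap m (i, j) (s, t) = cellMap m (i', j) (s', t) := by
    simp only [cellMap, e1]
  trans cellLabel m w p q n (i', j) (s', t)
  · rcases add_eq_add_cases hz.1 hz'.1 e1 with ⟨rfl, c2⟩ | ⟨rfl, c2, c3⟩ | ⟨rfl, c2, c3⟩ <;>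
      simp only at c2
    · rw [c2]
    · simp only at c3
      subst c2 c3
      exact h.cellLabel_horiz hl hs hb.1 ha.2 hz.2 hn
    · simp only at c3
      subst c2 c3
      rw [hmid] at hn
      exact (h.cellLabel_horiz hl hs ha.1 ha.2 hz.2 hn).symm
  · rcases add_eq_add_cases hz.2 hz'.2 e2 with ⟨rfl, c2⟩ | ⟨rfl, c2, c3⟩ | ⟨rfl, c2, c3⟩ <;>
      simp only at c2
    · rw [c2]
    · simp only at c3
      subst c2 c3
      rw [hmid] at hn
      exact h.cellLabel_vert hl hs hb.1 hb.2 hz'.1 hn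
    · simp only at c3
      subst c2 c3
      rw [e] at hn
      exact (h.cellLabel_vert hl hs hb.1 ha.2 hz'.1 hn).symm

theorem label_cellMap (h : IsPattern m w c r) (hl : IsLabelling m w c r p q) {n : ℕ}
    (hs : SideLabels m w p q n) {a : ℕ × ℕ} (ha : a.1 < m ∧ a.2 < m) {z : ℝ × ℝ} (hz : z ∈ unitSq)
    (hn : cellMap m a z ∉ whiteUnion m w (n + 1)) :
    label m w p q (n + 1) (cellMap m a z) = cellLabel m w p q n a z := by
  have hm := h.m_pos
  symm
  exact h.cellLabel_congr hl hs ha ⟨digit_lt hm _, digit_lt hm _⟩ hz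
    (cellInv_cellOf_mem hm (cellMap_mem ha.1 ha.2 hz)) (cellMap_cellInv hm _ _).symm hn

/-- Opposite exit cells are both white and the induction hypothesis gives a common `b`; all other
border cells are black and any `b` will do. The label of the resulting border vertex is then read
off from `IsLabelling.vert` or `IsLabelling.horiz`. -/
theorem sideLabels (h : IsPattern m w c r) (hl : IsLabelling m w c r p q) (n : ℕ) :
    SideLabels m w p q n := by
  have hm := h.m_pos
  have hr := h.r_lt
  have hc := h.c_lt
  have hv1 : (1 : ZMod 2).val = 1 := rfl
  have hm1 : m - 1 + 1 = m := by omega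
  induction n with
  | zero =>
    intro t ht
    exact ⟨fun h' => absurd ⟨by simp, ht⟩ h', fun h' => absurd ⟨ht, by simp⟩ h'⟩
  | succ n ih =>
    intro t ht
    obtain ⟨j, hj, s, hs, rfl⟩ := exists_digit hm ht
    refine ⟨fun h0 => ?_, fun h0 => ?_⟩
    · have h1 := mt (h.sides (n + 1) _).1.2 h0
      rw [← cellMap_left] at h0 ⊢
      rw [← cellMap_right hm] at h1 ⊢
      rw [h.label_cellMap hl ih ⟨hm, hj⟩ ⟨by simp, hs⟩ h0,
        h.label_cellMap hl ih ⟨by simp only; omega, hj⟩ ⟨by simp, hs⟩ h1]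
      obtain ⟨b, hb0, hb1⟩ : ∃ b : ZMod 2, cellLabel m w p q n (0, j) (0, s) =
          vertexLabel p q (0, j) (0, b) ∧ cellLabel m w p q n (m - 1, j) (1, s) =
          vertexLabel p q (m - 1, j) (1, b) := by
        by_cases hjr : j = r
        · have hw0 := (h.left j).2 hjr
          have hw1 := (h.right j).2 hjr
          obtain ⟨b, e0, e1⟩ := (ih s hs).1 fun h' => h0 ⟨_, hw0, _, h', rfl⟩
          exact ⟨b, by simp only [cellLabel, hw0, if_true, e0],
            by simp only [cellLabel, hw1, if_true, e1]⟩
        · have hw0 := mt (h.left j).1 hjr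
          have hw1 := mt (h.right j).1 hjr
          exact ⟨0, hl.vertexLabel_black hm hj hw0 _ _,
            hl.vertexLabel_black (by simp only; omega) hj hw1 _ _⟩
      have hb : j + b.val ≤ m := by have := ZMod.val_lt b; omega
      obtain ⟨v1, v2, v3, v4⟩ := hl.vert _ hb
      refine ⟨if r < j + b.val then 1 else 0, ?_, ?_⟩
      · rw [hb0]
        simp only [vertexLabel, ZMod.val_zero, add_zero, v1, v3]
      · rw [hb1]
        simp only [vertexLabel, hv1, hm1, v2, v4]
    · have h1 := mt (h.sides (n + 1) _).2.2 h0
      rw [← cellMap_bottom] at h0 ⊢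
      rw [← cellMap_top hm] at h1 ⊢
      rw [h.label_cellMap hl ih ⟨hj, hm⟩ ⟨hs, by simp⟩ h0,
        h.label_cellMap hl ih ⟨hj, by simp only; omega⟩ ⟨hs, by simp⟩ h1]
      obtain ⟨b, hb0, hb1⟩ : ∃ b : ZMod 2, cellLabel m w p q n (j, 0) (s, 0) =
          vertexLabel p q (j, 0) (b, 0) ∧ cellLabel m w p q n (j, m - 1) (s, 1) =
          vertexLabel p q (j, m - 1) (b, 1) := by
        by_cases hjr : j = c
        · have hw0 := (h.bottom j).2 hjr
          have hw1 := (h.top j).2 hjr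
          obtain ⟨b, e0, e1⟩ := (ih s hs).2 fun h' => h0 ⟨_, hw0, _, h', rfl⟩
          exact ⟨b, by simp only [cellLabel, hw0, if_true, e0],
            by simp only [cellLabel, hw1, if_true, e1]⟩
        · have hw0 := mt (h.bottom j).1 hjr
          have hw1 := mt (h.top j).1 hjr
          exact ⟨0, hl.vertexLabel_black hj hm hw0 _ _,
            hl.vertexLabel_black hj (by simp only; omega) hw1 _ _⟩
      have hb : j + b.val ≤ m := by have := ZMod.val_lt b; omega
      obtain ⟨v1, v2, v3, v4⟩ := hl.horiz _ hb
      refine ⟨if c < j + b.val then 1 else 0, ?_, ?_⟩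
      · rw [hb0]
        simp only [vertexLabel, ZMod.val_zero, add_zero, v1, v3]
      · rw [hb1]
        simp only [vertexLabel, hv1, hm1, v2, v4]

/-- Near `z` only the finitely many closed cells containing `z` matter. On each of them the label is
constant if the cell is black, and locally constant by induction if it is white. -/
theorem label_locally_constant (h : IsPattern m w c r) (hl : IsLabelling m w c r p q) (n : ℕ)
    {z : ℝ × ℝ} (hz : z ∈ unitSq) (hn : z ∉ whiteUnion m w n) :
    ∀ᶠ z' in 𝓝 z, z' ∈ unitSq → z' ∉ whiteUnion m w n → label m w p q n z' = label m w p q n z := by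
  have hm := h.m_pos
  induction n generalizing z with
  | zero => exact absurd hz hn
  | succ n ih =>
    have key : ∀ a ∈ Iio m ×ˢ Iio m, ∀ᶠ z' in 𝓝 z, z' ∈ cellMap m a '' unitSq →
        z' ∉ whiteUnion m w (n + 1) → label m w p q (n + 1) z' = label m w p q (n + 1) z := by
      intro a ha
      by_cases hza : z ∈ cellMap m a '' unitSq
      · obtain ⟨y, hy, rfl⟩ := hza
        rw [h.label_cellMap hl (h.sideLabels hl n) ha hy hn]
        by_cases hwa : w a
        · have hy' : y ∉ whiteUnion m w n := fun h' => hn ⟨_, hwa, _, h', rfl⟩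
          have hev := ih hy hy'
          have hcont := (continuous_cellInv (m := m) a).tendsto (cellMap m a y)
          rw [cellInv_cellMap hm] at hcont
          filter_upwards [hcont.eventually hev]
          rintro _ he ⟨x, hx, rfl⟩ hxn
          rw [cellInv_cellMap hm] at he
          rw [h.label_cellMap hl (h.sideLabels hl n) ha hx hxn]
          simp only [cellLabel, hwa, if_true]
          rw [he hx fun h' => hxn ⟨_, hwa, _, h', rfl⟩]
        · refine Eventually.of_forall ?_
          rintro _ ⟨x, hx, rfl⟩ hxn
          rw [h.label_cellMap hl (h.sideLabels hl n) ha hx hxn]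
          simp only [cellLabel, hwa, if_false]
      · have hcl : IsClosed (cellMap m a '' unitSq) :=
          (isCompact_unitSq.image (continuous_cellMap a)).isClosed
        filter_upwards [hcl.isOpen_compl.mem_nhds hza] with z' hz' hz''
        exact absurd hz'' hz'
    have hfin : (Iio m ×ˢ Iio m).Finite := (finite_Iio m).prod (finite_Iio m)
    filter_upwards [(eventually_all_finite hfin).2 key] with z' hall hz' hn'
    obtain ⟨a, h1, h2, y, hy, e⟩ := exists_cell hm hz'
    exact hall a ⟨h1, h2⟩ ⟨y, hy, e⟩ hn'

/-- For an excluded point the recursion has already met a black cell, so further depth changes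
nothing. -/
theorem label_succ (h : IsPattern m w c r) (n : ℕ)
    {z : ℝ × ℝ} (hz : z ∈ unitSq) (hn : z ∉ whiteUnion m w n) :
    label m w p q (n + 1) z = label m w p q n z := by
  have hm := h.m_pos
  induction n generalizing z with
  | zero => exact absurd hz hn
  | succ n ih =>
    change cellLabel m w p q (n + 1) (cellOf m z) (cellInv m (cellOf m z) z) =
      cellLabel m w p q n (cellOf m z) (cellInv m (cellOf m z) z)
    unfold cellLabel
    split_ifs with hw
    · rw [ih (cellInv_cellOf_mem hm hz)]
      exact fun h' => hn ⟨_, hw, _, h', cellMap_cellInv hm _ _⟩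
    · rfl

theorem label_eq_of_le (h : IsPattern m w c r) {n k : ℕ} (hnk : n ≤ k)
    {z : ℝ × ℝ} (hz : z ∈ unitSq) (hn : z ∉ whiteUnion m w n) :
    label m w p q k z = label m w p q n z := by
  induction k, hnk using Nat.le_induction with
  | base => rfl
  | succ k hk ih =>
    rw [h.label_succ k hz fun h' => hn (h.whiteUnion_antitone hk h'), ih]

/-- There is a locally constant function on the complement of the fractal that takes distinct values
at the corners of the square. -/
theorem exists_locally_constant (h : IsPattern m w c r) :
    ∃ g : ℝ × ℝ → ZMod 2 × ZMod 2,
      (∀ z ∈ unitSq \ squareFractal m w, ∀ᶠ z' in 𝓝[unitSq \ squareFractal m w] z, g z' = g z) ∧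
      Function.Injective (g ∘ corner) := by
  classical
  obtain ⟨p, q, h1, h2, h3⟩ := h.exists_labelling
  have hl : IsLabelling m w c r p q := ⟨h1, h2, h3⟩
  have hex : ∀ z ∈ unitSq \ squareFractal m w, ∃ n, z ∉ whiteUnion m w n := by
    intro z hz
    simpa [squareFractal] using hz.2
  let g : ℝ × ℝ → ZMod 2 × ZMod 2 := fun z =>
    if hz : ∃ n, z ∉ whiteUnion m w n then label m w p q (Nat.find hz) z else 0
  have hg : ∀ z ∈ unitSq, ∀ n, z ∉ whiteUnion m w n → g z = label m w p q n z := by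
    intro z hz n hn
    have hex : ∃ n, z ∉ whiteUnion m w n := ⟨n, hn⟩
    simp only [g, dif_pos hex]
    exact (h.label_eq_of_le (Nat.find_min' hex hn) hz (Nat.find_spec hex)).symm
  refine ⟨g, fun z hz => ?_, ?_⟩
  · obtain ⟨n, hn⟩ := hex z hz
    have hopen := (h.isCompact_whiteUnion n).isClosed.isOpen_compl.mem_nhds hn
    rw [eventually_nhdsWithin_iff]
    filter_upwards [hopen, h.label_locally_constant hl n hz.1 hn] with z' hz' hlab hmem
    rw [hg z hz.1 n hn, hg z' hmem.1 n hz', hlab hmem.1 hz']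
  · have hs := h.sideLabels hl 1
    have c00 := h.corner_notMem (s := 0) (t := 0) (by simp) (by simp)
    have c10 := h.corner_notMem (s := 1) (t := 0) (by simp) (by simp)
    have c01 := h.corner_notMem (s := 0) (t := 1) (by simp) (by simp)
    have c11 := h.corner_notMem (s := 1) (t := 1) (by simp) (by simp)
    -- Each corner lies on two sides of the square; one fixes the first component of its label, the
    -- other the second.
    obtain ⟨b₁, u1, u2⟩ := (hs 0 (by simp)).1 c00
    obtain ⟨b₂, u3, u4⟩ := (hs 1 (by simp)).1 c01
    obtain ⟨b₃, u5, u6⟩ := (hs 0 (by simp)).2 c00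
    obtain ⟨b₄, u7, u8⟩ := (hs 1 (by simp)).2 c10
    have g00 := hg _ (corner_mem 0) 1 c00
    have g10 := hg _ (corner_mem 1) 1 c10
    have g11 := hg _ (corner_mem 2) 1 c11
    have g01 := hg _ (corner_mem 3) 1 c01
    simp only [corner, Matrix.cons_val_zero, Matrix.cons_val_one, Matrix.cons_val] at g00 g10 g11 g01
    have E0 : g (corner 0) = (0, 0) := by
      simp only [corner, Matrix.cons_val_zero, g00]
      rw [u1] at u5 ⊢
      simp_all
    have E1 : g (corner 1) = (1, 0) := by
      simp only [corner, Matrix.cons_val_one, Matrix.cons_val_zero, g10]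
      rw [u2] at u7 ⊢
      simp_all
    have E2 : g (corner 2) = (1, 1) := by
      simp only [corner, Matrix.cons_val, g11]
      rw [u4] at u8 ⊢
      simp_all
    have E3 : g (corner 3) = (0, 1) := by
      simp only [corner, Matrix.cons_val, g01]
      rw [u3] at u6 ⊢
      simp_all
    have E : g ∘ corner = ![(0, 0), (1, 0), (1, 1), (0, 1)] := by
      funext i
      fin_cases i
      exacts [E0, E1, E2, E3]
    rw [E]
    decide

end IsPattern

end

/-! ### Piecewise affine maps from the unit square onto quadrilaterals -/

section

open Set Filter Topology

/-- The representation coefficients in the unit square. -/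
noncomputable def bary (z : ℝ × ℝ) : Fin 4 → ℝ :=
  ![1 - max z.1 z.2, max (z.1 - z.2) 0, min z.1 z.2, max (z.2 - z.1) 0]

/-- The map from the unit square onto `R` that is affine on both sides of the diagonal. -/
noncomputable def quadMap (R : Quad) (z : ℝ × ℝ) : Plane := ∑ i, bary z i • R i

theorem bary_lower {z : ℝ × ℝ} (h : z.2 ≤ z.1) : bary z = ![1 - z.1, z.1 - z.2, z.2, 0] := by
  simp [bary, h]

theorem bary_upper {z : ℝ × ℝ} (h : z.1 ≤ z.2) : bary z = ![1 - z.2, 0, z.1, z.2 - z.1] := by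
  simp [bary, h]

theorem quadMap_lower (R : Quad) {z : ℝ × ℝ} (h : z.2 ≤ z.1) :
    quadMap R z = (1 - z.1) • R 0 + (z.1 - z.2) • R 1 + z.2 • R 2 := by
  simp [quadMap, bary_lower h, Fin.sum_univ_four]

theorem quadMap_upper (R : Quad) {z : ℝ × ℝ} (h : z.1 ≤ z.2) :
    quadMap R z = (1 - z.2) • R 0 + z.1 • R 2 + (z.2 - z.1) • R 3 := by
  simp [quadMap, bary_upper h, Fin.sum_univ_four]

theorem continuous_quadMap (R : Quad) : Continuous (quadMap R) := by
  unfold quadMap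
  have hb : ∀ i, Continuous fun z => bary z i := by
    intro i
    fin_cases i <;> simp [bary] <;> fun_prop
  fun_prop

theorem quadMap_corner (R : Quad) (i : Fin 4) : quadMap R (corner i) = R i := by
  fin_cases i <;> simp [quadMap, bary, corner, Fin.sum_univ_four]

theorem bary_injective : Function.Injective bary := by
  intro z z' e
  have e1 := congrFun e 1
  have e2 := congrFun e 2
  have e3 := congrFun e 3
  simp only [bary, Matrix.cons_val_one, Matrix.cons_val, Matrix.cons_val_zero] at e1 e2 e3
  have key : ∀ x y : ℝ, max (x - y) 0 + min x y = x := by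
    intro x y
    rcases le_total x y with h | h <;> simp [h]
  apply Prod.ext
  · rw [← key z.1 z.2, e1, e2, key]
  · rw [← key z.2 z.1, min_comm, e3, e2, min_comm, key]

theorem isRep_bary (R : Quad) {z : ℝ × ℝ} (hz : z ∈ unitSq) : IsRep R (quadMap R z) (bary z) := by
  obtain ⟨⟨x0, x1⟩, y0, y1⟩ := hz
  rcases le_total z.1 z.2 with h | h
  · refine ⟨?_, ?_, ?_, rfl⟩
    · rw [bary_upper h]; intro i; fin_cases i <;> simp <;> linarith
    · rw [bary_upper h]; simp [Fin.sum_univ_four]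
    · rw [bary_upper h]; simp
  · refine ⟨?_, ?_, ?_, rfl⟩
    · rw [bary_lower h]; intro i; fin_cases i <;> simp <;> linarith
    · rw [bary_lower h]; simp [Fin.sum_univ_four]
    · rw [bary_lower h]; simp

theorem exists_bary {α : Fin 4 → ℝ} (h0 : ∀ i, 0 ≤ α i) (h1 : ∑ i, α i = 1)
    (h2 : α 1 = 0 ∨ α 3 = 0) : ∃ z ∈ unitSq, bary z = α := by
  rw [Fin.sum_univ_four] at h1
  have a0 := h0 0
  have a1 := h0 1
  have a2 := h0 2
  have a3 := h0 3
  refine ⟨(α 1 + α 2, α 2 + α 3), ⟨⟨by simp only; linarith, by simp only; linarith⟩,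
    ⟨by simp only; linarith, by simp only; linarith⟩⟩, ?_⟩
  rcases h2 with h2 | h2
  · rw [bary_upper (by simp only; linarith)]
    funext i; fin_cases i <;> simp <;> linarith
  · rw [bary_lower (by simp only; linarith)]
    funext i; fin_cases i <;> simp <;> linarith

/-! ### Representations of points in a convex quadrilateral -/

theorem IsConvexQuad.cross_pos {Q : Quad} (hQ : IsConvexQuad Q) :
    0 < cross (Q 1 - Q 0) (Q 2 - Q 1) ∧ 0 < cross (Q 2 - Q 1) (Q 3 - Q 2) ∧
    0 < cross (Q 3 - Q 2) (Q 0 - Q 3) ∧ 0 < cross (Q 0 - Q 3) (Q 1 - Q 0) :=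
  ⟨hQ 0, hQ 1, hQ 2, hQ 3⟩

/-- The equation `key` compares signed distances from the diagonal through `Q 0` and `Q 2`. The
vertices `Q 1` and `Q 3` lie strictly on opposite sides of it, and one of their coefficients
vanishes, so the distance determines both coefficients. -/
theorem IsRep.unique {Q : Quad} (hQ : IsConvexQuad Q) {x : Plane} {α β : Fin 4 → ℝ}
    (hα : IsRep Q x α) (hβ : IsRep Q x β) : α = β := by
  obtain ⟨a0, a1, a2, a3⟩ := hα
  obtain ⟨b0, b1, b2, b3⟩ := hβ
  obtain ⟨c0, -, c2, -⟩ := hQ.cross_pos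
  have e : ∑ i, α i • Q i = ∑ i, β i • Q i := a3.trans b3.symm
  have ex := congrArg (fun v : Plane => v 0) e
  have ey := congrArg (fun v : Plane => v 1) e
  simp only [Fin.sum_univ_four, PiLp.add_apply, PiLp.smul_apply, smul_eq_mul] at ex ey
  rw [Fin.sum_univ_four] at a1 b1
  simp only [cross, PiLp.sub_apply] at c0 c2
  set A0 := (Q 1 0 - Q 0 0) * (Q 2 1 - Q 1 1) - (Q 1 1 - Q 0 1) * (Q 2 0 - Q 1 0) with hA0
  set A2 := (Q 3 0 - Q 2 0) * (Q 0 1 - Q 3 1) - (Q 3 1 - Q 2 1) * (Q 0 0 - Q 3 0) with hA2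
  have hs : α 0 + α 1 + α 2 + α 3 = β 0 + β 1 + β 2 + β 3 := a1.trans b1.symm
  have key : (α 1 - β 1) * A0 = (α 3 - β 3) * A2 := by
    rw [hA0, hA2]
    linear_combination (Q 2 1 - Q 0 1) * ex - (Q 2 0 - Q 0 0) * ey +
      ((Q 2 0 - Q 0 0) * Q 0 1 - (Q 2 1 - Q 0 1) * Q 0 0) * hs
  have hA0' := c0.ne'
  have hA2' := c2.ne'
  have h13 : α 1 = β 1 ∧ α 3 = β 3 := by
    have z1 : α 1 = β 1 → α 3 = β 3 := fun h => by
      rw [h, sub_self, zero_mul, eq_comm, mul_eq_zero] at key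
      rcases key with key | key
      · linarith
      · exact absurd key hA2'
    have z3 : α 3 = β 3 → α 1 = β 1 := fun h => by
      rw [h, sub_self, zero_mul, mul_eq_zero] at key
      rcases key with key | key
      · linarith
      · exact absurd key hA0'
    have hα1 := a0 1
    have hα3 := a0 3
    have hβ1 := b0 1
    have hβ3 := b0 3
    rcases a2 with a2 | a2 <;> rcases b2 with b2 | b2
    · have h1 : α 1 = β 1 := a2.trans b2.symm
      exact ⟨h1, z1 h1⟩
    · have h1 : 0 ≤ β 1 * A0 := mul_nonneg hβ1 c0.le
      have h2 : 0 ≤ α 3 * A2 := mul_nonneg hα3 c2.le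
      rw [a2, b2] at key
      have h3 : β 1 * A0 = 0 := by linarith
      have h4 : α 1 = β 1 := by
        rcases mul_eq_zero.1 h3 with h | h
        · rw [a2, h]
        · exact absurd h hA0'
      exact ⟨h4, z1 h4⟩
    · have h1 : 0 ≤ α 1 * A0 := mul_nonneg hα1 c0.le
      have h2 : 0 ≤ β 3 * A2 := mul_nonneg hβ3 c2.le
      rw [a2, b2] at key
      have h3 : α 1 * A0 = 0 := by linarith
      have h4 : α 1 = β 1 := by
        rcases mul_eq_zero.1 h3 with h | h
        · rw [b2, h]
        · exact absurd h hA0'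
      exact ⟨h4, z1 h4⟩
    · have h3 : α 3 = β 3 := a2.trans b2.symm
      exact ⟨z3 h3, h3⟩
  obtain ⟨h1, h3⟩ := h13
  have h0 : (α 0 - β 0) * A0 = 0 := by
    rw [hA0]
    rw [h1, h3] at ex ey hs
    linear_combination (-(Q 1 0 - Q 0 0)) * ey + (Q 1 1 - Q 0 1) * ex +
      ((Q 1 0 - Q 0 0) * Q 2 1 - (Q 1 1 - Q 0 1) * Q 2 0) * hs
  have h0' : α 0 = β 0 := by
    rcases mul_eq_zero.1 h0 with h | h
    · linarith
    · exact absurd h hA0'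
  funext i
  fin_cases i
  · exact h0'
  · exact h1
  · simp only [Fin.reduceFinMk]; linarith
  · exact h3

theorem rep_quadMap {Q : Quad} (hQ : IsConvexQuad Q) {z : ℝ × ℝ} (hz : z ∈ unitSq) :
    rep Q (quadMap Q z) = bary z :=
  IsRep.unique hQ (Classical.epsilon_spec ⟨_, isRep_bary Q hz⟩) (isRep_bary Q hz)

theorem P_quadMap {Q : Quad} (hQ : IsConvexQuad Q) (R : Quad) {z : ℝ × ℝ} (hz : z ∈ unitSq) :
    P Q R (quadMap Q z) = quadMap R z := by
  rw [P, rep_quadMap hQ hz, quadMap]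

theorem quadMap_injOn {Q : Quad} (hQ : IsConvexQuad Q) : InjOn (quadMap Q) unitSq := by
  intro z hz z' hz' e
  apply bary_injective
  rw [← rep_quadMap hQ hz, e, rep_quadMap hQ hz']

/-- The vertices satisfy an affine relation `hdep` with positive coefficients. Along it weight is
moved from `Q 1` and `Q 3` to `Q 0` and `Q 2` until one of the former two has none left, that is,
with `t` the smaller of `β 1 / A2` and `β 3 / A0`. -/
theorem exists_isRep_of_sum {Q : Quad} (hQ : IsConvexQuad Q) {β : Fin 4 → ℝ} (h0 : ∀ i, 0 ≤ β i)
    (h1 : ∑ i, β i = 1) : ∃ α, IsRep Q (∑ i, β i • Q i) α := by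
  obtain ⟨c0, c1, c2, c3⟩ := hQ.cross_pos
  set A0 := cross (Q 1 - Q 0) (Q 2 - Q 1) with hA0
  set A1 := cross (Q 2 - Q 1) (Q 3 - Q 2) with hA1
  set A2 := cross (Q 3 - Q 2) (Q 0 - Q 3) with hA2
  set A3 := cross (Q 0 - Q 3) (Q 1 - Q 0) with hA3
  have hsum : A1 + A3 = A0 + A2 := by
    simp only [hA0, hA1, hA2, hA3, cross, PiLp.sub_apply]; ring
  have hdep : A1 • Q 0 + A3 • Q 2 = A2 • Q 1 + A0 • Q 3 := by
    ext i
    fin_cases i <;>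
      simp only [hA0, hA1, hA2, hA3, cross, PiLp.sub_apply, PiLp.add_apply, PiLp.smul_apply,
        smul_eq_mul, Fin.zero_eta, Fin.mk_one] <;> ring
  have b0 := h0 0
  have b1 := h0 1
  have b2 := h0 2
  have b3 := h0 3
  rw [Fin.sum_univ_four] at h1
  have main : ∀ t : ℝ, 0 ≤ t → t * A2 ≤ β 1 → t * A0 ≤ β 3 → (t * A2 = β 1 ∨ t * A0 = β 3) →
      ∃ α, IsRep Q (∑ i, β i • Q i) α := by
    intro t ht h2 h3 h4
    refine ⟨![β 0 + t * A1, β 1 - t * A2, β 2 + t * A3, β 3 - t * A0], ?_, ?_, ?_, ?_⟩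
    · have := mul_nonneg ht c1.le
      have := mul_nonneg ht c3.le
      intro i; fin_cases i <;> simp <;> linarith
    · simp only [Fin.sum_univ_four, Matrix.cons_val_zero, Matrix.cons_val_one, Matrix.cons_val]
      linear_combination h1 + t * hsum
    · simp only [Matrix.cons_val_zero, Matrix.cons_val_one, Matrix.cons_val]
      rcases h4 with h4 | h4
      · left; linarith
      · right; linarith
    · simp only [Fin.sum_univ_four, Matrix.cons_val_zero, Matrix.cons_val_one, Matrix.cons_val]
      have : (β 0 + t * A1) • Q 0 + (β 1 - t * A2) • Q 1 + (β 2 + t * A3) • Q 2 +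
          (β 3 - t * A0) • Q 3 = β 0 • Q 0 + β 1 • Q 1 + β 2 • Q 2 + β 3 • Q 3 +
          t • ((A1 • Q 0 + A3 • Q 2) - (A2 • Q 1 + A0 • Q 3)) := by module
      rw [this, hdep, sub_self, smul_zero, add_zero]
  rcases le_total (β 1 / A2) (β 3 / A0) with h | h
  · refine main (β 1 / A2) (by positivity) (by field_simp; rfl) ?_ (Or.inl (by field_simp))
    rwa [le_div_iff₀ c0] at h
  · refine main (β 3 / A0) (by positivity) ?_ (by field_simp; rfl) (Or.inr (by field_simp))
    rwa [le_div_iff₀ c2] at h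

theorem carrier_eq_image {R : Quad} (hR : IsConvexQuad R) : carrier R = quadMap R '' unitSq := by
  apply Subset.antisymm
  · intro x hx
    have hx' : ∃ β : Fin 4 → ℝ, (∀ i, 0 ≤ β i) ∧ ∑ i, β i = 1 ∧ ∑ i, β i • R i = x := by
      rw [carrier, convexHull_range_eq_exists_affineCombination] at hx
      obtain ⟨s, u, hu0, hu1, rfl⟩ := hx
      classical
      refine ⟨fun i => if i ∈ s then u i else 0, ?_, ?_, ?_⟩
      · intro i; dsimp only; split_ifs with h
        · exact hu0 i h
        · rfl
      · rw [← hu1]; simp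
      · rw [Finset.affineCombination_eq_linear_combination _ _ _ hu1]
        simp [ite_smul]
    obtain ⟨β, h0, h1, rfl⟩ := hx'
    obtain ⟨α, a0, a1, a2, a3⟩ := exists_isRep_of_sum hR h0 h1
    obtain ⟨z, hz, rfl⟩ := exists_bary a0 a1 a2
    exact ⟨z, hz, a3⟩
  · rintro _ ⟨z, hz, rfl⟩
    obtain ⟨a0, a1, -, -⟩ := isRep_bary R hz
    exact (convex_convexHull ℝ _).sum_mem (fun i _ => a0 i) a1
      fun i _ => subset_convexHull ℝ _ (mem_range_self i)

/-- A homothety of the unit square onto a subsquare whose interior either lies on one side of the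
diagonal or which is bisected by it. -/
def IsAdapted (T : ℝ × ℝ → ℝ × ℝ) : Prop :=
  ∃ ρ a b : ℝ, 0 < ρ ∧ 0 ≤ a ∧ 0 ≤ b ∧ a + ρ ≤ 1 ∧ b + ρ ≤ 1 ∧ (a = b ∨ b + ρ ≤ a ∨ a + ρ ≤ b) ∧
    T = fun z => (a + ρ * z.1, b + ρ * z.2)

theorem isAdapted_id : IsAdapted id :=
  ⟨1, 0, 0, by simp, by simp, by simp, by simp, by simp, by simp, by funext z; simp⟩

theorem IsAdapted.comp {T T' : ℝ × ℝ → ℝ × ℝ} (h : IsAdapted T) (h' : IsAdapted T') :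
    IsAdapted (T ∘ T') := by
  obtain ⟨ρ, a, b, h1, h2, h3, h4, h5, h6, rfl⟩ := h
  obtain ⟨ρ', a', b', k1, k2, k3, k4, k5, k6, rfl⟩ := h'
  refine ⟨ρ * ρ', a + ρ * a', b + ρ * b', by positivity, by positivity, by positivity, by nlinarith,
    by nlinarith, ?_, by funext z; simp only [Function.comp, Prod.mk.injEq]; constructor <;> ring⟩
  rcases h6 with rfl | h6 | h6
  · rcases k6 with rfl | k6 | k6
    · exact Or.inl rfl
    · right; left; nlinarith
    · right; right; nlinarith
  · right; left; nlinarith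
  · right; right; nlinarith

theorem isAdapted_cellMap {m : ℕ} {a : ℕ × ℕ} (h1 : a.1 < m) (h2 : a.2 < m) :
    IsAdapted (cellMap m a) := by
  have hm : (0 : ℝ) < m := by exact_mod_cast (by omega : 0 < m)
  have h1' : (a.1 : ℝ) + 1 ≤ m := by exact_mod_cast h1
  have h2' : (a.2 : ℝ) + 1 ≤ m := by exact_mod_cast h2
  refine ⟨1 / m, a.1 / m, a.2 / m, by positivity, by positivity, by positivity, ?_, ?_, ?_, ?_⟩
  · rw [← add_div, div_le_one hm]; exact h1'
  · rw [← add_div, div_le_one hm]; exact h2'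
  · rcases lt_trichotomy a.1 a.2 with h | h | h
    · right; right
      rw [← add_div, div_le_div_iff_of_pos_right hm]
      exact_mod_cast h
    · left; rw [h]
    · right; left
      rw [← add_div, div_le_div_iff_of_pos_right hm]
      exact_mod_cast h
  · funext z
    simp only [cellMap, Prod.mk.injEq]
    constructor <;> ring

/-- The quadrilateral with the vertices of the image of the square under `T`. -/
noncomputable def imageQuad (Q : Quad) (T : ℝ × ℝ → ℝ × ℝ) : Quad := fun i => quadMap Q (T (corner i))

theorem IsConvexQuad.of_cross_pos {R : Quad}
    (h0 : 0 < cross (R 1 - R 0) (R 2 - R 1)) (h1 : 0 < cross (R 2 - R 1) (R 3 - R 2))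
    (h2 : 0 < cross (R 3 - R 2) (R 0 - R 3)) (h3 : 0 < cross (R 0 - R 3) (R 1 - R 0)) :
    IsConvexQuad R := by
  intro i
  fin_cases i
  exacts [h0, h1, h2, h3]

theorem cross_smul_smul (s t : ℝ) (u v : Plane) : cross (s • u) (t • v) = s * t * cross u v := by
  simp only [cross, PiLp.smul_apply, smul_eq_mul]; ring

theorem isConvexQuad_parallelogram {R : Quad} {u v : Plane} (huv : 0 < cross u v)
    (h1 : R 1 - R 0 = u) (h2 : R 2 - R 1 = v) (h3 : R 3 - R 2 = -u) (h4 : R 0 - R 3 = -v) :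
    IsConvexQuad R := by
  apply IsConvexQuad.of_cross_pos <;> simp only [h1, h2, h3, h4] <;>
    simp only [cross, PiLp.neg_apply] at * <;> linarith

/-- Away from the diagonal `quadMap Q` is affine on the subsquare, whose image is a parallelogram. A
subsquare bisected by the diagonal is folded exactly where the unit square is, and its image has the
sides of `Q` scaled by `ρ`. -/
theorem IsAdapted.quadMap_imageQuad {Q : Quad} (hQ : IsConvexQuad Q) {T : ℝ × ℝ → ℝ × ℝ}
    (hT : IsAdapted T) :
    IsConvexQuad (imageQuad Q T) ∧
      ∀ z ∈ unitSq, quadMap (imageQuad Q T) z = quadMap Q (T z) := by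
  obtain ⟨ρ, a, b, h1, h2, h3, h4, h5, h6, rfl⟩ := hT
  obtain ⟨c0, c1, c2, c3⟩ := hQ.cross_pos
  have hρ : 0 < ρ * ρ := by positivity
  rcases h6 with rfl | h6 | h6
  · have r0 : imageQuad Q (fun z => (a + ρ * z.1, a + ρ * z.2)) 0 =
        (1 - a) • Q 0 + a • Q 2 := by
      simp only [imageQuad, corner, Matrix.cons_val_zero]
      rw [quadMap_lower _ (by simp)]; simp only; module
    have r1 : imageQuad Q (fun z => (a + ρ * z.1, a + ρ * z.2)) 1 =
        (1 - a - ρ) • Q 0 + ρ • Q 1 + a • Q 2 := by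
      simp only [imageQuad, corner, Matrix.cons_val_one, Matrix.cons_val_zero]
      rw [quadMap_lower _ (by simp only; linarith)]; simp only; module
    have r2 : imageQuad Q (fun z => (a + ρ * z.1, a + ρ * z.2)) 2 =
        (1 - a - ρ) • Q 0 + (a + ρ) • Q 2 := by
      simp only [imageQuad, corner, Matrix.cons_val]
      rw [quadMap_lower _ (by simp)]; simp only; module
    have r3 : imageQuad Q (fun z => (a + ρ * z.1, a + ρ * z.2)) 3 =
        (1 - a - ρ) • Q 0 + a • Q 2 + ρ • Q 3 := by
      simp only [imageQuad, corner, Matrix.cons_val]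
      rw [quadMap_upper _ (by simp only; linarith)]; simp only; module
    constructor
    · apply IsConvexQuad.of_cross_pos <;> simp only [r0, r1, r2, r3]
      · refine (mul_pos hρ c0).trans_eq ?_
        rw [← cross_smul_smul]; congr 1 <;> module
      · refine (mul_pos hρ c1).trans_eq ?_
        rw [← cross_smul_smul]; congr 1 <;> module
      · refine (mul_pos hρ c2).trans_eq ?_
        rw [← cross_smul_smul]; congr 1 <;> module
      · refine (mul_pos hρ c3).trans_eq ?_
        rw [← cross_smul_smul]; congr 1 <;> module
    · intro z hz
      rcases le_total z.2 z.1 with h | h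
      · rw [quadMap_lower _ h, quadMap_lower _ (by simp only; nlinarith), r0, r1, r2]
        simp only; module
      · rw [quadMap_upper _ h, quadMap_upper _ (by simp only; nlinarith), r0, r2, r3]
        simp only; module
  · have low : ∀ z ∈ unitSq, quadMap Q (a + ρ * z.1, b + ρ * z.2) =
        (1 - a) • Q 0 + (a - b) • Q 1 + b • Q 2 + (ρ * z.1) • (Q 1 - Q 0) +
          (ρ * z.2) • (Q 2 - Q 1) := by
      rintro z ⟨⟨x0, x1⟩, y0, y1⟩
      rw [quadMap_lower _ (by simp only; nlinarith)]; simp only; module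
    have hr : ∀ i, imageQuad Q (fun z => (a + ρ * z.1, b + ρ * z.2)) i = _ :=
      fun i => low _ (corner_mem i)
    constructor
    · refine isConvexQuad_parallelogram (u := ρ • (Q 1 - Q 0)) (v := ρ • (Q 2 - Q 1))
        (by rw [cross_smul_smul]; positivity) ?_ ?_ ?_ ?_ <;> rw [hr, hr] <;> simp [corner]
    · intro z hz
      rw [low z hz]
      rcases le_total z.2 z.1 with h | h
      · rw [quadMap_lower _ h, hr, hr, hr]; simp [corner]; module
      · rw [quadMap_upper _ h, hr, hr, hr]; simp [corner]; module
  · have up : ∀ z ∈ unitSq, quadMap Q (a + ρ * z.1, b + ρ * z.2) =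
        (1 - b) • Q 0 + (b - a) • Q 3 + a • Q 2 + (ρ * z.1) • (Q 2 - Q 3) +
          (ρ * z.2) • (Q 3 - Q 0) := by
      rintro z ⟨⟨x0, x1⟩, y0, y1⟩
      rw [quadMap_upper _ (by simp only; nlinarith)]; simp only; module
    have hr : ∀ i, imageQuad Q (fun z => (a + ρ * z.1, b + ρ * z.2)) i = _ :=
      fun i => up _ (corner_mem i)
    constructor
    · refine isConvexQuad_parallelogram (u := ρ • (Q 2 - Q 3)) (v := ρ • (Q 3 - Q 0))
        ?_ ?_ ?_ ?_ ?_
      · rw [cross_smul_smul]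
        refine mul_pos hρ ?_
        refine c2.trans_eq ?_
        simp only [cross, PiLp.sub_apply]; ring
      all_goals rw [hr, hr]; simp [corner]
    · intro z hz
      rw [up z hz]
      rcases le_total z.2 z.1 with h | h
      · rw [quadMap_lower _ h, hr, hr, hr]; simp [corner]; module
      · rw [quadMap_upper _ h, hr, hr, hr]; simp [corner]; module

end

/-! ### Transfer to the quadrilateral -/

section

open Set Filter Topology

variable {m : ℕ} {Q : Quad} {W : Set Quad}

/-- The index `k` of the cell `a` of the grid. -/
def cellIndex (m : ℕ) (a : ℕ × ℕ) : Fin 4 → ℕ :=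
  ![m - 1 - max a.1 a.2, a.1 - a.2, min a.1 a.2, a.2 - a.1]

/-- In square coordinates `Q 1` and `Q 2` have abscissa 1, and `Q 2` and `Q 3` have ordinate 1; this
gives the lower left vertex of the cell. -/
theorem exists_cellIndex {k : Fin 4 → ℕ} (hk : k ∈ A m) :
    k 1 + k 2 < m ∧ k 2 + k 3 < m ∧ k = cellIndex m (k 1 + k 2, k 2 + k 3) := by
  rcases hk with (⟨h1, h2, h3⟩ | ⟨h1, h2, h3⟩) | ⟨h1, h2, h3⟩
  all_goals
    refine ⟨by omega, by omega, ?_⟩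
    funext i
    fin_cases i <;> simp [cellIndex] <;> omega

theorem cellIndex_mem {a : ℕ × ℕ} (h1 : a.1 < m) (h2 : a.2 < m) : cellIndex m a ∈ A m := by
  rcases lt_trichotomy a.1 a.2 with h | h | h
  · exact Or.inl (Or.inr ⟨by simp [cellIndex]; omega, by simp [cellIndex]; omega,
      by simp [cellIndex]; omega⟩)
  · exact Or.inr ⟨by simp [cellIndex]; omega, by simp [cellIndex]; omega,
      by simp [cellIndex]; omega⟩
  · exact Or.inl (Or.inl ⟨by simp [cellIndex]; omega, by simp [cellIndex]; omega,
      by simp [cellIndex]; omega⟩)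

theorem gridPoint_eq (Q : Quad) (m : ℕ) (k : Fin 4 → ℕ) (c : Fin 4 → ℝ) :
    gridPoint Q m k c = (((k 0 : ℝ) + c 0) / m) • Q 0 + (((k 1 : ℝ) + c 1) / m) • Q 1 +
      (((k 2 : ℝ) + c 2) / m) • Q 2 + (((k 3 : ℝ) + c 3) / m) • Q 3 := by
  simp only [gridPoint, Fin.sum_univ_four, smul_add, smul_smul, div_eq_inv_mul]

theorem S_cellIndex (Q : Quad) {a : ℕ × ℕ} (h1 : a.1 < m) (h2 : a.2 < m) :
    S Q m (cellIndex m a) = imageQuad Q (cellMap m a) := by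
  obtain ⟨x, y⟩ := a
  simp only at h1 h2
  have hm : (m : ℝ) ≠ 0 := by
    have : m ≠ 0 := by omega
    exact_mod_cast this
  have hm0 : (0 : ℝ) < m := by positivity
  rcases lt_trichotomy x y with h | h | h
  -- Writing `y` and `m` as sums removes the truncated subtractions of `cellIndex`.
  · obtain ⟨d, rfl⟩ : ∃ d, y = x + 1 + d := ⟨y - x - 1, by omega⟩
    obtain ⟨e, rfl⟩ : ∃ e, m = x + 1 + d + 1 + e := ⟨m - (x + 1 + d) - 1, by omega⟩
    have k0 : cellIndex (x + 1 + d + 1 + e) (x, x + 1 + d) = ![e, 0, x, d + 1] := by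
      funext i; fin_cases i <;> simp [cellIndex] <;> omega
    rw [k0]
    simp only [S]
    funext i
    push_cast at hm hm0
    fin_cases i <;> simp [imageQuad, cellMap, corner, gridPoint_eq] <;>
      rw [quadMap_upper _ (by simp only; rw [div_le_div_iff_of_pos_right hm0]; linarith)] <;>
      simp only <;> match_scalars <;> field_simp <;> ring
  · subst h
    obtain ⟨e, rfl⟩ : ∃ e, m = x + 1 + e := ⟨m - x - 1, by omega⟩
    have k0 : cellIndex (x + 1 + e) (x, x) = ![e, 0, x, 0] := by
      funext i; fin_cases i <;> simp [cellIndex]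
    rw [k0]
    simp only [S]
    funext i
    push_cast at hm hm0
    fin_cases i <;> simp [imageQuad, cellMap, corner, gridPoint_eq]
    · rw [quadMap_upper _ (by simp only; rw [div_le_div_iff_of_pos_right hm0])]
      simp only; match_scalars <;> field_simp <;> ring
    · rw [quadMap_lower _ (by simp only; rw [div_le_div_iff_of_pos_right hm0]; linarith)]
      simp only; match_scalars <;> field_simp <;> ring
    · rw [quadMap_upper _ (by simp only; rw [div_le_div_iff_of_pos_right hm0])]
      simp only; match_scalars <;> field_simp <;> ring
    · rw [quadMap_upper _ (by simp only; rw [div_le_div_iff_of_pos_right hm0]; linarith)]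
      simp only; match_scalars <;> field_simp <;> ring
  · obtain ⟨d, rfl⟩ : ∃ d, x = y + 1 + d := ⟨x - y - 1, by omega⟩
    obtain ⟨e, rfl⟩ : ∃ e, m = y + 1 + d + 1 + e := ⟨m - (y + 1 + d) - 1, by omega⟩
    have k0 : cellIndex (y + 1 + d + 1 + e) (y + 1 + d, y) = ![e, d + 1, y, 0] := by
      funext i; fin_cases i <;> simp [cellIndex] <;> omega
    rw [k0]
    simp only [S]
    funext i
    push_cast at hm hm0
    fin_cases i <;> simp [imageQuad, cellMap, corner, gridPoint_eq] <;>
      rw [quadMap_lower _ (by simp only; rw [div_le_div_iff_of_pos_right hm0]; linarith)] <;>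
      simp only <;> match_scalars <;> field_simp <;> ring

/-- The white cells corresponding to a set of quadrilaterals. -/
def whiteCell (Q : Quad) (m : ℕ) (W : Set Quad) (a : ℕ × ℕ) : Prop :=
  a.1 < m ∧ a.2 < m ∧ S Q m (cellIndex m a) ∈ W

theorem mem_iff_exists_whiteCell (hW : W ⊆ grid Q m) (R : Quad) :
    R ∈ W ↔ ∃ a, whiteCell Q m W a ∧ R = imageQuad Q (cellMap m a) := by
  constructor
  · intro hR
    obtain ⟨k, hk, rfl⟩ := hW hR
    obtain ⟨h1, h2, h3⟩ := exists_cellIndex hk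
    rw [h3] at hR
    exact ⟨_, ⟨h1, h2, hR⟩, by conv_lhs => rw [h3, S_cellIndex Q h1 h2]⟩
  · rintro ⟨a, ⟨h1, h2, h3⟩, rfl⟩
    rwa [S_cellIndex Q h1 h2] at h3

/-- The homotheties of the white cells of order `n`. -/
def cellMaps (m : ℕ) (w : ℕ × ℕ → Prop) : ℕ → Set (ℝ × ℝ → ℝ × ℝ)
  | 0 => {id}
  | n + 1 => {T | ∃ T' ∈ cellMaps m w n, ∃ a, w a ∧ T = T' ∘ cellMap m a}

/-- New cells enter `cellMaps` on the inside, as in `white`, but enter `whiteUnion` on the outside;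
associativity of composition reconciles the two. -/
theorem cellMaps_succ_iff (w : ℕ × ℕ → Prop) (n : ℕ) (T : ℝ × ℝ → ℝ × ℝ) :
    T ∈ cellMaps m w (n + 1) ↔ ∃ a, w a ∧ ∃ T' ∈ cellMaps m w n, T = cellMap m a ∘ T' := by
  induction n generalizing T with
  | zero => simp [cellMaps]
  | succ n ih =>
    constructor
    · rintro ⟨T', hT', a, ha, rfl⟩
      obtain ⟨b, hb, T'', hT'', rfl⟩ := (ih T').1 hT'
      exact ⟨b, hb, T'' ∘ cellMap m a, ⟨T'', hT'', a, ha, rfl⟩, rfl⟩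
    · rintro ⟨b, hb, T', ⟨T'', hT'', a, ha, rfl⟩, rfl⟩
      exact ⟨cellMap m b ∘ T'', (ih _).2 ⟨b, hb, T'', hT'', rfl⟩, a, ha, rfl⟩

theorem whiteUnion_eq (w : ℕ × ℕ → Prop) (n : ℕ) :
    whiteUnion m w n = ⋃ T ∈ cellMaps m w n, T '' unitSq := by
  induction n with
  | zero => simp [whiteUnion, cellMaps]
  | succ n ih =>
    ext z
    simp only [whiteUnion, mem_ofPred_eq, ih, mem_iUnion, exists_prop, cellMaps_succ_iff]
    constructor
    · rintro ⟨a, ha, z', ⟨T, hT, y, hy, rfl⟩, rfl⟩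
      exact ⟨_, ⟨a, ha, T, hT, rfl⟩, y, hy, rfl⟩
    · rintro ⟨_, ⟨a, ha, T, hT, rfl⟩, y, hy, rfl⟩
      exact ⟨a, ha, T y, ⟨T, hT, y, hy, rfl⟩, rfl⟩

theorem isAdapted_of_mem_cellMaps {n : ℕ} {T : ℝ × ℝ → ℝ × ℝ}
    (hT : T ∈ cellMaps m (whiteCell Q m W) n) : IsAdapted T := by
  induction n generalizing T with
  | zero => rw [hT]; exact isAdapted_id
  | succ n ih =>
    obtain ⟨T', hT', a, ha, rfl⟩ := hT
    exact (ih hT').comp (isAdapted_cellMap ha.1 ha.2.1)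

/-- The shift to `n + 1` arises because `white Q W 0` is already of order 1. In the step, `P` from
`Q` to `imageQuad Q T` acts in square coordinates as `T`, since `T` is adapted. -/
theorem mem_white_iff (hQ : IsConvexQuad Q) (hW : W ⊆ grid Q m) (n : ℕ) (R : Quad) :
    R ∈ white Q W n ↔ ∃ T ∈ cellMaps m (whiteCell Q m W) (n + 1), R = imageQuad Q T := by
  induction n generalizing R with
  | zero =>
    rw [white, mem_iff_exists_whiteCell hW]
    simp [cellMaps]
  | succ n ih =>
    have key : ∀ T ∈ cellMaps m (whiteCell Q m W) (n + 1), ∀ a, whiteCell Q m W a →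
        (fun i => P Q (imageQuad Q T) (imageQuad Q (cellMap m a) i)) =
          imageQuad Q (T ∘ cellMap m a) := by
      intro T hT a ha
      funext i
      have hmem : cellMap m a (corner i) ∈ unitSq := cellMap_mem ha.1 ha.2.1 (corner_mem i)
      change P Q (imageQuad Q T) (quadMap Q (cellMap m a (corner i))) = _
      rw [P_quadMap hQ _ hmem, ((isAdapted_of_mem_cellMaps hT).quadMap_imageQuad hQ).2 _ hmem]
      rfl
    constructor
    · rintro ⟨V, hV, U, hU, rfl⟩
      obtain ⟨T, hT, rfl⟩ := (ih V).1 hV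
      obtain ⟨a, ha, rfl⟩ := (mem_iff_exists_whiteCell hW U).1 hU
      exact ⟨_, ⟨T, hT, a, ha, rfl⟩, key T hT a ha⟩
    · rintro ⟨_, ⟨T, hT, a, ha, rfl⟩, rfl⟩
      exact ⟨_, (ih _).2 ⟨T, hT, rfl⟩, _, (mem_iff_exists_whiteCell hW _).2 ⟨a, ha, rfl⟩,
        (key T hT a ha).symm⟩

theorem iUnion_carrier_eq (hQ : IsConvexQuad Q) (hW : W ⊆ grid Q m) (n : ℕ) :
    ⋃ R ∈ white Q W n, carrier R = quadMap Q '' whiteUnion m (whiteCell Q m W) (n + 1) := by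
  have hcar : ∀ T ∈ cellMaps m (whiteCell Q m W) (n + 1),
      carrier (imageQuad Q T) = quadMap Q '' (T '' unitSq) := by
    intro T hT
    obtain ⟨h1, h2⟩ := (isAdapted_of_mem_cellMaps hT).quadMap_imageQuad hQ
    rw [carrier_eq_image h1, image_image]
    exact image_congr h2
  rw [whiteUnion_eq, image_iUnion₂]
  ext x
  simp only [mem_iUnion, exists_prop, mem_white_iff hQ hW]
  constructor
  · rintro ⟨_, ⟨T, hT, rfl⟩, hx⟩
    exact ⟨T, hT, hcar T hT ▸ hx⟩
  · rintro ⟨T, hT, hx⟩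
    exact ⟨_, ⟨T, hT, rfl⟩, (hcar T hT).symm ▸ hx⟩

theorem fractal_eq (hQ : IsConvexQuad Q) (hW : W ⊆ grid Q m) {c r : ℕ}
    (h : IsPattern m (whiteCell Q m W) c r) :
    fractal Q W = quadMap Q '' squareFractal m (whiteCell Q m W) := by
  have e : squareFractal m (whiteCell Q m W) = ⋂ n, whiteUnion m (whiteCell Q m W) (n + 1) := by
    apply Subset.antisymm
    · exact subset_iInter fun n => iInter_subset _ (n + 1)
    · exact subset_iInter fun n => (iInter_subset _ n).trans (h.whiteUnion_succ_subset n)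
  rw [e, fractal]
  simp only [iUnion_carrier_eq hQ hW]
  refine (InjOn.image_iInter_eq ((quadMap_injOn hQ).mono ?_)).symm
  exact iUnion_subset fun n => h.whiteUnion_subset _

theorem carrier_diff_fractal (hQ : IsConvexQuad Q) (hW : W ⊆ grid Q m) {c r : ℕ}
    (h : IsPattern m (whiteCell Q m W) c r) :
    carrier Q \ fractal Q W = quadMap Q '' (unitSq \ squareFractal m (whiteCell Q m W)) := by
  rw [fractal_eq hQ hW h, carrier_eq_image hQ, (quadMap_injOn hQ).image_sdiff_subset]
  exact iInter_subset _ 0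

/-! ### Common sides of quadrilaterals and neighbouring cells -/

theorem imageQuad_cellMap_injective (hQ : IsConvexQuad Q) {a b : ℕ × ℕ} (ha : a.1 < m ∧ a.2 < m)
    (hb : b.1 < m ∧ b.2 < m) (e : imageQuad Q (cellMap m a) = imageQuad Q (cellMap m b)) :
    a = b := by
  have e0 := quadMap_injOn hQ (cellMap_mem ha.1 ha.2 (corner_mem 0))
    (cellMap_mem hb.1 hb.2 (corner_mem 0)) (congrFun e 0)
  obtain ⟨e1, e2⟩ := cellMap_eq_cellMap (by omega) e0
  simp only [add_left_inj, Nat.cast_inj] at e1 e2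
  exact Prod.ext e1 e2

/-- An endpoint is extreme in its segment: a convex combination of points with parameters `s, t ≥ 0`
has parameter 0 only if each point of positive weight does. -/
theorem eq_or_eq_of_mem_segment {E : Type*} [AddCommGroup E] [Module ℝ E] {x y x' y' : E}
    (hx : x ∈ segment ℝ x' y') (hy : y ∈ segment ℝ x' y') (hx' : x' ∈ segment ℝ x y) :
    x' = x ∨ x' = y := by
  rw [segment_eq_image'] at hx hy
  obtain ⟨s, ⟨s0, -⟩, rfl⟩ := hx
  obtain ⟨t, ⟨t0, -⟩, rfl⟩ := hy
  obtain ⟨α, β, hα, hβ, hαβ, e⟩ := hx'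
  have e' : (α * s + β * t) • (y' - x') = 0 := by
    have : α • (x' + s • (y' - x')) + β • (x' + t • (y' - x')) =
      (α + β) • x' + (α * s + β * t) • (y' - x') := by module
    rw [this, hαβ, one_smul] at e
    simpa using e
  rcases smul_eq_zero.1 e' with h | h
  · have h1 : α * s = 0 := by nlinarith [mul_nonneg hα s0, mul_nonneg hβ t0]
    have h2 : β * t = 0 := by nlinarith [mul_nonneg hα s0, mul_nonneg hβ t0]
    rcases mul_eq_zero.1 h1 with h1 | h1
    · rcases mul_eq_zero.1 h2 with h2 | h2
      · linarith
      · right; simp [h2]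
    · left; simp [h1]
  · left; simp [h]

theorem endpoints_of_segment_eq {E : Type*} [AddCommGroup E] [Module ℝ E] {x y x' y' : E}
    (h : segment ℝ x y = segment ℝ x' y') :
    (x = x' ∨ x = y') ∧ (y = x' ∨ y = y') ∧ (x' = x ∨ x' = y) ∧ (y' = x ∨ y' = y) := by
  have hx : x ∈ segment ℝ x' y' := h ▸ left_mem_segment ℝ x y
  have hy : y ∈ segment ℝ x' y' := h ▸ right_mem_segment ℝ x y
  have hx' : x' ∈ segment ℝ x y := h ▸ left_mem_segment ℝ x' y'
  have hy' : y' ∈ segment ℝ x y := h ▸ right_mem_segment ℝ x' y'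
  refine ⟨eq_or_eq_of_mem_segment hx' hy' hx, ?_, eq_or_eq_of_mem_segment hx hy hx', ?_⟩
  · exact (eq_or_eq_of_mem_segment (segment_symm ℝ x y ▸ hy') (segment_symm ℝ x y ▸ hx')
      (segment_symm ℝ x' y' ▸ hy)).symm
  · exact (eq_or_eq_of_mem_segment (segment_symm ℝ x' y' ▸ hy) (segment_symm ℝ x' y' ▸ hx)
      (segment_symm ℝ x y ▸ hy')).symm

/-- The vertices of the cell `a` in the integer lattice. -/
def latticeVertex (a : ℕ × ℕ) : Fin 4 → ℕ × ℕ :=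
  ![(a.1, a.2), (a.1 + 1, a.2), (a.1 + 1, a.2 + 1), (a.1, a.2 + 1)]

theorem cellMap_corner (a : ℕ × ℕ) (i : Fin 4) :
    cellMap m a (corner i) = (((latticeVertex a i).1 / m : ℝ), ((latticeVertex a i).2 / m : ℝ)) := by
  fin_cases i <;> simp [cellMap, corner, latticeVertex]

theorem imageQuad_vertex_eq_iff (hQ : IsConvexQuad Q) {a b : ℕ × ℕ} (ha : a.1 < m ∧ a.2 < m)
    (hb : b.1 < m ∧ b.2 < m) (i j : Fin 4) :
    imageQuad Q (cellMap m a) i = imageQuad Q (cellMap m b) j ↔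
      latticeVertex a i = latticeVertex b j := by
  have hm : (m : ℝ) ≠ 0 := by exact_mod_cast (by omega : m ≠ 0)
  rw [imageQuad, imageQuad, (quadMap_injOn hQ).eq_iff (cellMap_mem ha.1 ha.2 (corner_mem i))
    (cellMap_mem hb.1 hb.2 (corner_mem j)), cellMap_corner, cellMap_corner, Prod.mk.injEq,
    div_left_inj' hm, div_left_inj' hm, Nat.cast_inj, Nat.cast_inj, Prod.ext_iff]

theorem haveCommonSide_iff (hQ : IsConvexQuad Q) {a b : ℕ × ℕ} (ha : a.1 < m ∧ a.2 < m)
    (hb : b.1 < m ∧ b.2 < m) (hab : a ≠ b) :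
    HaveCommonSide (imageQuad Q (cellMap m a)) (imageQuad Q (cellMap m b)) ↔ Neighbor a b := by
  constructor
  · rintro ⟨i, j, e⟩
    obtain ⟨e1, e2, e3, e4⟩ := endpoints_of_segment_eq e
    rw [imageQuad_vertex_eq_iff hQ ha hb, imageQuad_vertex_eq_iff hQ ha hb] at e1 e2
    rw [imageQuad_vertex_eq_iff hQ hb ha, imageQuad_vertex_eq_iff hQ hb ha] at e3 e4
    obtain ⟨x, y⟩ := a
    obtain ⟨x', y'⟩ := b
    simp only [ne_eq, Prod.mk.injEq] at hab
    simp only [Neighbor]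
    fin_cases i <;> fin_cases j <;> simp [latticeVertex] at e1 e2 e3 e4 <;> omega
  -- Both cells are traversed anticlockwise, so they run through a common side in opposite
  -- directions.
  · have side : ∀ i j : Fin 4, latticeVertex a i = latticeVertex b (j + 1) →
        latticeVertex a (i + 1) = latticeVertex b j →
        HaveCommonSide (imageQuad Q (cellMap m a)) (imageQuad Q (cellMap m b)) := by
      intro i j h1 h2
      refine ⟨i, j, ?_⟩
      rw [(imageQuad_vertex_eq_iff hQ ha hb _ _).2 h1, (imageQuad_vertex_eq_iff hQ ha hb _ _).2 h2,
        segment_symm]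
    rintro (⟨h1, h2⟩ | ⟨h1, h2⟩ | ⟨h1, h2⟩ | ⟨h1, h2⟩)
    · exact side 1 3 (by simp [latticeVertex, h1, h2]) (by simp [latticeVertex, h1, h2])
    · exact side 3 1 (by simp [latticeVertex, h1, h2]) (by simp [latticeVertex, h1, h2])
    · exact side 2 0 (by simp [latticeVertex, h1, h2]) (by simp [latticeVertex, h1, h2])
    · exact side 0 2 (by simp [latticeVertex, h1, h2]) (by simp [latticeVertex, h1, h2])

theorem isTree_cellGraph (hQ : IsConvexQuad Q) (hW : W ⊆ grid Q m)
    (ht : (whiteGraph W).IsTree) : (cellGraph (whiteCell Q m W)).IsTree := by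
  let f : {a // whiteCell Q m W a} → W := fun a =>
    ⟨imageQuad Q (cellMap m a.1), (mem_iff_exists_whiteCell hW _).2 ⟨a.1, a.2, rfl⟩⟩
  have hlt : ∀ a : {a // whiteCell Q m W a}, a.1.1 < m ∧ a.1.2 < m := fun a => ⟨a.2.1, a.2.2.1⟩
  have hf : Function.Bijective f := by
    constructor
    · intro a b e
      exact Subtype.ext (imageQuad_cellMap_injective hQ (hlt a) (hlt b) (congrArg Subtype.val e))
    · rintro ⟨R, hR⟩
      obtain ⟨a, ha, rfl⟩ := (mem_iff_exists_whiteCell hW R).1 hR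
      exact ⟨⟨a, ha⟩, rfl⟩
  let iso : cellGraph (whiteCell Q m W) ≃g whiteGraph W :=
    { toEquiv := Equiv.ofBijective f hf
      map_rel_iff' := by
        intro a b
        change (f a ≠ f b ∧ HaveCommonSide (f a).1 (f b).1) ↔ Neighbor a.1 b.1
        by_cases hab : a = b
        · subst hab
          simp [Neighbor]
        · rw [and_iff_right (hf.1.ne hab)]
          exact haveCommonSide_iff hQ (hlt a) (hlt b) fun e => hab (Subtype.ext e) }
  exact iso.isTree_iff.2 ht

/-! ### Border cells and the position of the exits -/

theorem isBorderIndex_cellIndex {x y : ℕ} (hx : x < m) (hy : y < m)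
    (h : x = 0 ∨ y = 0 ∨ x = m - 1 ∨ y = m - 1) : IsBorderIndex (cellIndex m (x, y)) := by
  rcases h with rfl | rfl | rfl | rfl
  · refine ⟨3, fun j hj => ?_⟩
    fin_cases j <;> simp [cellIndex] at hj ⊢
  · refine ⟨0, fun j hj => ?_⟩
    fin_cases j <;> simp [cellIndex] at hj ⊢
  · refine ⟨1, fun j hj => ?_⟩
    fin_cases j <;> simp [cellIndex] at hj ⊢; omega
  · refine ⟨2, fun j hj => ?_⟩
    fin_cases j <;> simp [cellIndex] at hj ⊢; omega

/-- The side from `Q 0` to `Q 1` is the bottom of the square, so the left and right exits of `Q`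
become the bottom and top cells of one column. -/
theorem IsLeftRightPair.cells {k : Fin 4 → ℕ} (h : IsLeftRightPair Q m W k) :
    k = cellIndex m (k 1, 0) ∧ ![0, 0, k 1, k 0] = cellIndex m (k 1, m - 1) ∧
      whiteCell Q m W (k 1, 0) ∧ whiteCell Q m W (k 1, m - 1) := by
  obtain ⟨hk, h2, h3, h4, h5⟩ := h
  obtain ⟨e1, e2, e3⟩ := exists_cellIndex hk
  rw [h2, h3, add_zero] at e3
  have e0 := congrFun e3 0
  simp only [cellIndex, Matrix.cons_val_zero] at e0
  have e4 : ![0, 0, k 1, k 0] = cellIndex m (k 1, m - 1) := by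
    funext i; fin_cases i <;> simp [cellIndex] <;> omega
  refine ⟨e3, e4, ⟨by simp only; omega, by simp only; omega, e3 ▸ h4⟩,
    ⟨by simp only; omega, by simp only; omega, e4 ▸ h5⟩⟩

theorem IsTopBottomPair.cells {k : Fin 4 → ℕ} (h : IsTopBottomPair Q m W k) :
    k = cellIndex m (0, k 3) ∧ ![0, k 0, k 3, 0] = cellIndex m (m - 1, k 3) ∧
      whiteCell Q m W (0, k 3) ∧ whiteCell Q m W (m - 1, k 3) := by
  obtain ⟨hk, h2, h3, h4, h5⟩ := h
  obtain ⟨e1, e2, e3⟩ := exists_cellIndex hk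
  rw [h2, h3, zero_add, zero_add] at e3
  have e0 := congrFun e3 0
  simp only [cellIndex, Matrix.cons_val_zero] at e0
  have e4 : ![0, k 0, k 3, 0] = cellIndex m (m - 1, k 3) := by
    funext i; fin_cases i <;> simp [cellIndex] <;> omega
  refine ⟨e3, e4, ⟨by simp only; omega, by simp only; omega, e3 ▸ h4⟩,
    ⟨by simp only; omega, by simp only; omega, e4 ▸ h5⟩⟩

theorem exists_white_neighbor {w : ℕ × ℕ → Prop} (hconn : (cellGraph w).Connected) {a b : ℕ × ℕ}
    (ha : w a) (hb : w b) (hab : a ≠ b) : ∃ d, w d ∧ Neighbor a d := by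
  obtain ⟨p⟩ := hconn.preconnected ⟨a, ha⟩ ⟨b, hb⟩
  cases p with
  | nil => exact absurd rfl hab
  | cons h _ => exact ⟨_, Subtype.property _, h⟩

/-- If the column exits were corner cells, the corner conditions would keep the row exits out of the
corners. Both neighbours of a corner cell lie on the border, so a white one must be an exit in row
`r`. The bottom corner then gives `r = 1` and the top one `r = m - 2`, which is impossible for `m ≥
4`. -/
theorem exit_ne_corner {w : ℕ × ℕ → Prop} {c r : ℕ} (hm : 4 ≤ m)
    (hlt : ∀ a, w a → a.1 < m ∧ a.2 < m) (htree : (cellGraph w).IsTree)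
    (hb : w (c, 0)) (ht : w (c, m - 1)) (hl : w (0, r)) (hr : w (m - 1, r))
    (hc₁ : ¬ (w (0, 0) ∧ w (m - 1, m - 1))) (hc₂ : ¬ (w (m - 1, 0) ∧ w (0, m - 1)))
    (hbd : ∀ x y, w (x, y) → (x = 0 ∨ y = 0 ∨ x = m - 1 ∨ y = m - 1) →
      (x = c ∧ y = 0) ∨ (x = c ∧ y = m - 1) ∨ (x = 0 ∧ y = r) ∨ (x = m - 1 ∧ y = r)) :
    0 < c ∧ c + 1 < m := by
  have hcm := (hlt _ hb).1
  simp only at hcm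
  by_contra hcon
  have hc : c = 0 ∨ c = m - 1 := by omega
  have hr0 : r ≠ 0 := by
    rintro rfl
    rcases hc with rfl | rfl
    · exact hc₂ ⟨hr, ht⟩
    · exact hc₁ ⟨hl, ht⟩
  have hrm : r ≠ m - 1 := by
    rintro rfl
    rcases hc with rfl | rfl
    · exact hc₁ ⟨hb, hr⟩
    · exact hc₂ ⟨hb, hl⟩
  have hne : (c, 0) ≠ (c, m - 1) := by simp only [ne_eq, Prod.mk.injEq]; omega
  have h1 : r = 1 := by
    obtain ⟨⟨x, y⟩, h, hn⟩ := exists_white_neighbor htree.connected hb ht hne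
    have hx := hlt _ h
    simp only [Neighbor] at hx hn
    rcases hbd x y h (by omega) with h' | h' | h' | h' <;> omega
  have h2 : r = m - 2 := by
    obtain ⟨⟨x, y⟩, h, hn⟩ := exists_white_neighbor htree.connected ht hb hne.symm
    have hx := hlt _ h
    simp only [Neighbor] at hx hn
    rcases hbd x y h (by omega) with h' | h' | h' | h' <;> omega
  omega

theorem isPattern_of_exits {w : ℕ × ℕ → Prop} {c r : ℕ} (hm : 4 ≤ m)
    (hlt : ∀ a, w a → a.1 < m ∧ a.2 < m) (htree : (cellGraph w).IsTree)
    (hb : w (c, 0)) (ht : w (c, m - 1)) (hl : w (0, r)) (hr : w (m - 1, r))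
    (hc₁ : ¬ (w (0, 0) ∧ w (m - 1, m - 1))) (hc₂ : ¬ (w (m - 1, 0) ∧ w (0, m - 1)))
    (hbd : ∀ x y, w (x, y) → (x = 0 ∨ y = 0 ∨ x = m - 1 ∨ y = m - 1) →
      (x = c ∧ y = 0) ∨ (x = c ∧ y = m - 1) ∨ (x = 0 ∧ y = r) ∨ (x = m - 1 ∧ y = r)) :
    IsPattern m w c r := by
  obtain ⟨c0, c1⟩ := exit_ne_corner hm hlt htree hb ht hl hr hc₁ hc₂ hbd
  -- Reflection in the diagonal exchanges rows and columns.
  obtain ⟨r0, r1⟩ := exit_ne_corner (w := fun a => w a.swap) (c := r) (r := c) hm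
    (fun a ha => (hlt _ ha).symm) ((cellGraphSwap w).isTree_iff.1 htree) hl hr hb ht hc₁
    (fun h => hc₂ h.symm) (fun x y h h' => by have := hbd y x h (by omega); omega)
  refine ⟨hlt, fun y => ⟨fun h => ?_, ?_⟩, fun y => ⟨fun h => ?_, ?_⟩,
    fun x => ⟨fun h => ?_, ?_⟩, fun x => ⟨fun h => ?_, ?_⟩, c0, c1, r0, r1, htree⟩
  · have := hbd _ _ h (by simp); omega
  · rintro rfl; exact hl
  · have := hbd _ _ h (by simp); omega
  · rintro rfl; exact hr
  · have := hbd _ _ h (by simp); omega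
  · rintro rfl; exact hb
  · have := hbd _ _ h (by simp); omega
  · rintro rfl; exact ht

theorem IsLabyrinthSet.exists_isPattern (hQ : IsConvexQuad Q) (hm : 4 ≤ m)
    (hW : IsLabyrinthSet Q m W)
    (hborder : ∀ k ∈ A m, IsBorderIndex k → S Q m k ∈ W → IsExit Q m W (S Q m k)) :
    ∃ c r, IsPattern m (whiteCell Q m W) c r := by
  have htree := isTree_cellGraph hQ hW.subset_grid hW.tree
  obtain ⟨k, hk, hku⟩ := hW.exit_left_right
  obtain ⟨l, hl, hlu⟩ := hW.exit_top_bottom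
  obtain ⟨k1, k2, kb, kt⟩ := hk.cells
  obtain ⟨l1, l2, ll, lr⟩ := hl.cells
  have hc3 := hW.corner₁₃
  have hc4 := hW.corner₂₄
  obtain ⟨c, hck⟩ : ∃ c, c = k 1 := ⟨_, rfl⟩
  obtain ⟨r, hrl⟩ : ∃ r, r = l 3 := ⟨_, rfl⟩
  rw [← hck] at k1 k2 kb kt
  rw [← hrl] at l1 l2 ll lr
  have hcm : c < m := kb.1
  have hrm : r < m := ll.2.1
  have hinj : ∀ {x y x' y' : ℕ}, x < m → y < m → x' < m → y' < m →
      S Q m (cellIndex m (x, y)) = S Q m (cellIndex m (x', y')) → x = x' ∧ y = y' := by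
    intro x y x' y' h1 h2 h3 h4 e
    rw [S_cellIndex Q h1 h2, S_cellIndex Q h3 h4] at e
    simpa using imageQuad_cellMap_injective hQ (a := (x, y)) (b := (x', y')) ⟨h1, h2⟩ ⟨h3, h4⟩ e
  have hbd : ∀ x y, whiteCell Q m W (x, y) → (x = 0 ∨ y = 0 ∨ x = m - 1 ∨ y = m - 1) →
      (x = c ∧ y = 0) ∨ (x = c ∧ y = m - 1) ∨ (x = 0 ∧ y = r) ∨ (x = m - 1 ∧ y = r) := by
    rintro x y ⟨hx, hy, hxy⟩ h
    simp only at hx hy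
    rcases hborder _ (cellIndex_mem hx hy) (isBorderIndex_cellIndex hx hy h) hxy with
      ⟨k', hk', e⟩ | ⟨l', hl', e⟩
    · rw [hku k' hk'] at e
      rw [← hck, k2, k1] at e
      rcases e with e | e
      · exact Or.inl (hinj hx hy hcm (by omega) e)
      · exact Or.inr (Or.inl (hinj hx hy hcm (by omega) e))
    · rw [hlu l' hl'] at e
      rw [← hrl, l2, l1] at e
      rcases e with e | e
      · exact Or.inr (Or.inr (Or.inl (hinj hx hy (by omega) hrm e)))
      · exact Or.inr (Or.inr (Or.inr (hinj hx hy (by omega) hrm e)))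
  have hlt : ∀ a, whiteCell Q m W a → a.1 < m ∧ a.2 < m := fun a ha => ⟨ha.1, ha.2.1⟩
  have d00 : ![m - 1, 0, 0, 0] = cellIndex m (0, 0) := by
    funext i; fin_cases i <;> simp [cellIndex]
  have d11 : ![0, 0, m - 1, 0] = cellIndex m (m - 1, m - 1) := by
    funext i; fin_cases i <;> simp [cellIndex]
  have d10 : ![0, m - 1, 0, 0] = cellIndex m (m - 1, 0) := by
    funext i; fin_cases i <;> simp [cellIndex]
  have d01 : ![0, 0, 0, m - 1] = cellIndex m (0, m - 1) := by
    funext i; fin_cases i <;> simp [cellIndex]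
  rw [d00, d11] at hc3
  rw [d10, d01] at hc4
  have hc3' : ¬ (whiteCell Q m W (0, 0) ∧ whiteCell Q m W (m - 1, m - 1)) :=
    fun h => hc3 ⟨h.1.2.2, h.2.2.2⟩
  have hc4' : ¬ (whiteCell Q m W (m - 1, 0) ∧ whiteCell Q m W (0, m - 1)) :=
    fun h => hc4 ⟨h.1.2.2, h.2.2.2⟩
  exact ⟨c, r, isPattern_of_exits hm hlt htree kb kt ll lr hc3' hc4' hbd⟩

/-- A set that is the image of `Y` under an embedding has exactly the components of the points `q i`
if every point of `Y` is connected to one of them and a locally constant function separates them. -/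
theorem bijective_mk_of_image {E F ι L : Type*} [TopologicalSpace E] [TopologicalSpace F]
    [T2Space F] {K Y : Set E} (hK : IsCompact K) (hYK : Y ⊆ K) {f : E → F} (hf : Continuous f)
    (hinj : InjOn f K) {q : ι → E} (hq : ∀ i, q i ∈ Y)
    (hconn : ∀ y ∈ Y, ∃ i, ConnectedIn Y y (q i)) {g : E → L}
    (hg : ∀ y ∈ Y, ∀ᶠ y' in 𝓝[Y] y, g y' = g y) (hgq : Function.Injective (g ∘ q)) :
    Function.Bijective fun i =>
      (ConnectedComponents.mk (⟨f (q i), mem_image_of_mem f (hq i)⟩ : ↥(f '' Y))) := by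
  have : CompactSpace K := isCompact_iff_compactSpace.1 hK
  have hemb : IsEmbedding (K.domRestrict f) :=
    (hf.comp continuous_subtype_val).isClosedEmbedding (injOn_iff_injective.1 hinj) |>.isEmbedding
  have hψ : IsEmbedding (Y.domRestrict f) := hemb.comp (IsEmbedding.inclusion hYK)
  let e : Y ≃ₜ ↥(f '' Y) := hψ.toHomeomorph.trans (Homeomorph.setCongr (range_domRestrict f Y))
  constructor
  · intro i j hij
    apply hgq
    have hlc : IsLocallyConstant fun y : Y => g y := by
      rw [IsLocallyConstant.iff_eventually_eq]
      intro y
      have := hg y y.2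
      rw [nhdsWithin_eq_map_subtype_coe y.2] at this
      exact this
    have hlc' : IsLocallyConstant fun x => g (e.symm x) := hlc.comp_continuous e.symm.continuous
    have hcomp := ConnectedComponents.coe_eq_coe'.1 hij
    have hval := hlc'.apply_eq_of_isPreconnected isPreconnected_connectedComponent hcomp
      mem_connectedComponent
    have hes : ∀ i, e.symm ⟨f (q i), mem_image_of_mem f (hq i)⟩ = ⟨q i, hq i⟩ := fun i =>
      (Homeomorph.symm_apply_eq e).2 rfl
    simpa only [hes, Function.comp] using hval
  · intro x
    obtain ⟨⟨_, y, hy, rfl⟩, rfl⟩ := ConnectedComponents.surjective_coe x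
    obtain ⟨i, s, hs, hsc, hys, his⟩ := hconn y hy
    refine ⟨i, ?_⟩
    have hpre : IsPreconnected ((↑) ⁻¹' (f '' s) : Set ↥(f '' Y)) := by
      rw [← IsInducing.subtypeVal.isPreconnected_image, Subtype.image_preimage_coe,
        inter_eq_right.2 (image_mono hs)]
      exact hsc.image f hf.continuousOn
    exact ConnectedComponents.coe_eq_coe'.2
      (hpre.subset_connectedComponent (mem_image_of_mem f hys) (mem_image_of_mem f his))

end

end QuadLabyrinth

open QuadLabyrinth
theorem theorem4p4 (Q : Quad) (hQ : IsConvexQuad Q)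
    (hdiag : dist (Q 0) (Q 2) ≤ dist (Q 1) (Q 3))
    (m : ℕ) (hm : 4 ≤ m) (W : Set Quad) (hW : IsLabyrinthSet Q m W)
    (hborder : ∀ k ∈ A m, IsBorderIndex k → S Q m k ∈ W → IsExit Q m W (S Q m k)) :
    Nat.card (ConnectedComponents ↥(carrier Q \ fractal Q W)) = 4 ∧
    ∃ h : ∀ i : Fin 4, Q i ∈ carrier Q \ fractal Q W,
      Function.Bijective (fun i : Fin 4 =>
        (ConnectedComponents.mk (⟨Q i, h i⟩ : ↥(carrier Q \ fractal Q W)))) := by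
  obtain ⟨c, r, hp⟩ := hW.exists_isPattern hQ hm hborder
  obtain ⟨g, hg, hgq⟩ := hp.exists_locally_constant
  have hq : ∀ i, corner i ∈ unitSq \ squareFractal m (whiteCell Q m W) := fun i =>
    ⟨corner_mem i, hp.corner_notMem_squareFractal i⟩
  have hbij := bijective_mk_of_image isCompact_unitSq Set.sdiff_subset (continuous_quadMap Q)
    (quadMap_injOn hQ) hq (fun _ hy => hp.connectedIn_corner hy) hg hgq
  simp only [quadMap_corner] at hbij
  rw [carrier_diff_fractal hQ hW.subset_grid hp]
  refine ⟨?_, fun i => ⟨corner i, hq i, quadMap_corner Q i⟩, hbij⟩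
  rw [← Nat.card_eq_of_bijective _ hbij, Nat.card_fin]
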